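/- Let $P$ be a finite set, and for a permutation $\pi$ let $z(\pi)$ be its number of cycles, fixed points included. A pair $(\sigma,\alpha)$ of permutations of $P$ is a \emph{hypermap} if the group $\langle\sigma,\alpha\rangle$ has exactly one orbit on $P$ (so $P\neq\emptyset$); its \emph{genus} $g(\sigma,\alpha)$ is given by $|P|+2-2g(\sigma,\alpha)=z(\sigma)+z(\alpha)+z(\alpha^{-1}\sigma)$. A permutation $\theta$ of $P$ is a \emph{refinement} of $\alpha$ if every cycle of $\alpha$, viewed as a set $C$ of points, is mapped to itself by $\theta$ and the restrictions to $C$ satisfy $g(\theta|_C,\alpha|_C)=0$. A \emph{spanning hypertree} of $(\sigma,\alpha)$ is a pair $(\sigma,\theta)$ where $\theta$ is a refinement of $\alpha$ such that $(\sigma,\theta)$ is a hypermap with $z(\theta^{-1}\sigma)=1$ and $g(\sigma,\theta)=0$. Let $(\sigma,\alpha)$ be a hypermap such that every cycle of $\alpha$ has at most three points. Its \emph{associated two-colored graph} $G=G(\sigma,\alpha)$ is the following graph, in which loops and parallel edges are allowed. For each point $i$ lying on a $3$-cycle of $\alpha$ take a new (white) point $i'$; the points of $P$ are black. Let $\widetilde\sigma$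 be the permutation of all black and white points that has all cycles of $\sigma$ and, for each $3$-cycle $(i,j,k)$ of $\alpha$, the cycle $(i',k',j')$. Let $\widetilde\alpha$ be the permutation of all these points that has all $2$-cycles of $\alpha$, the $2$-cycle $(i,i')$ for each point $i$ lying on a $3$-cycle of $\alpha$, and no other non-trivial cycles. The vertices of $G$ are the cycles of $\widetilde\sigma$, and each $2$-cycle $(p,q)$ of $\widetilde\alpha$ is an edge of $G$ joining the cycle of $\widetilde\sigma$ containing $p$ to the cycle of $\widetilde\sigma$ containing $q$. Let $V$ be the set of all vertices of $G$, and $W\subseteq V$ the set of white vertices, that is, of the cycles of $\widetilde\sigma$ consisting of white points. For $X\subseteq V$ let $G|_X$ be the graph with vertex set $X$ whose edges are the edges of $G$ with both endpoints in $X$, and let $s(H)$ be the number of spanning trees of a graph $H$ (parallel edges being distinguished). Then the number of spanning hypertrees of $(\sigma,\alpha)$ equals $$\sum_{S\subseteq W}(-2)^{|S|}\,s\left(G|_{V\setminus S}\right).$$ -/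

import Mathlib

namespace Hypermap

open Equiv

noncomputable section

/-- The set of cycles of a permutation, fixed points being cycles of length one. -/
abbrev Cycles {P : Type*} (π : Perm P) : Type _ := Quotient (Perm.SameCycle.setoid π)

/-- The cycle of `π` that contains the point `p`. -/
abbrev cycleAt {P : Type*} (π : Perm P) (p : P) : Cycles π :=
  Quotient.mk (Perm.SameCycle.setoid π) p

/-- `z π`: the number of cycles of `π`, fixed points included. -/
def z {P : Type*} (π : Perm P) : ℕ := Nat.card (Cycles π)

/-- `κ σ α`: the number of orbits of the group generated by `σ` and `α`. -/
def κ {P : Type*} (σ α : Perm P) : ℕ :=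
  Nat.card (MulAction.orbitRel.Quotient (Subgroup.closure {σ, α} : Subgroup (Perm P)) P)

/-- The pair `(σ, α)` is a hypermap: it has exactly one connected component. -/
def IsHypermap {P : Type*} (σ α : Perm P) : Prop := κ σ α = 1

/-- The genus `g` of a hypermap `(σ, α)` on `n` points, determined by
`n + 2 - 2 g = z(σ) + z(α) + z(α⁻¹ σ)`. It is only used for pairs generating a transitive
group. -/
def genus {P : Type*} (σ α : Perm P) : ℚ :=
  ((Nat.card P : ℚ) + 2 - z σ - z α - z (α⁻¹ * σ)) / 2

/-- `θ` is a refinement of `γ`: every cycle of `γ` is, as a set of points, invariant under `θ`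
(so that it is a union of cycles of `θ`), and the permutations `θᵢ`, `γᵢ` induced by `θ` and `γ`
on such a set satisfy `g(θᵢ, γᵢ) = 0`. -/
def IsRefinement {P : Type*} (θ γ : Perm P) : Prop :=
  ∃ h : ∀ x y : P, γ.SameCycle x (θ y) ↔ γ.SameCycle x y,
    ∀ x : P, genus
      (θ.subtypePerm (p := fun y => γ.SameCycle x y) (h x))
      (γ.subtypePerm (p := fun y => γ.SameCycle x y) (fun _ => Perm.sameCycle_apply_right)) = 0

/-- `(σ, θ)` is a spanning hypertree of `(σ, α)`: `θ` refines `α`, the pair `(σ, θ)` is a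
hypermap, it has exactly one face, and its genus is zero. -/
def IsSpanningHypertree {P : Type*} (σ α θ : Perm P) : Prop :=
  IsRefinement θ α ∧ IsHypermap σ θ ∧ z (θ⁻¹ * σ) = 1 ∧ genus σ θ = 0

/-- The number of spanning hypertrees of `(σ, α)`. -/
def numSpanningHypertrees {P : Type*} (σ α : Perm P) : ℕ :=
  Nat.card {θ : Perm P // IsSpanningHypertree σ α θ}

/-- All cycles of `α` have at most three points (the length of the cycle of `α` through `p` is
the minimal period of `p`). -/
def HasShortHyperedges {P : Type*} (α : Perm P) : Prop :=
  ∀ p : P, Function.minimalPeriod α p ≤ 3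

/-- The white points: one copy `i'` of each point `i` lying on a `3`-cycle of `α`. -/
abbrev White {P : Type*} (α : Perm P) : Type _ := {i : P // Function.minimalPeriod α i = 3}

theorem minimalPeriod_apply_eq {P : Type*} [Finite P] (α : Perm P) (i : P) :
    Function.minimalPeriod α (α i) = Function.minimalPeriod α i :=
  Function.minimalPeriod_apply (α.injective.mem_periodicPts i)

theorem minimalPeriod_symm_apply_eq {P : Type*} [Finite P] (α : Perm P) (i : P) :
    Function.minimalPeriod α (α.symm i) = Function.minimalPeriod α i := by
  rw [← minimalPeriod_apply_eq α (α.symm i), Equiv.apply_symm_apply]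

/-- The vertex permutation of the associated two-colored map, on black points `inl i` and white
points `inr i'`: it keeps the cycles of `σ`, and has a cycle `(i', k', j')` for each `3`-cycle
`(i, j, k)` of `α`. -/
def assocVertexPerm {P : Type*} [Finite P] (σ α : Perm P) : Perm (P ⊕ White α) :=
  Perm.sumCongr σ
    ((α.subtypePerm (p := fun i => Function.minimalPeriod α i = 3)
      (fun i => by rw [minimalPeriod_apply_eq]))⁻¹)

open Classical in
/-- The edge permutation of the associated two-colored map: it exchanges `i` and `i'` for every
point `i` on a `3`-cycle of `α`, and keeps the other cycles of `α` (which are `2`-cycles and fixed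
points when `α` has short hyperedges). -/
def assocEdgePerm {P : Type*} [Finite P] (α : Perm P) : Perm (P ⊕ White α) where
  toFun := Sum.elim
    (fun i => if h : Function.minimalPeriod α i = 3 then Sum.inr ⟨i, h⟩ else Sum.inl (α i))
    (fun w => Sum.inl w.1)
  invFun := Sum.elim
    (fun i => if h : Function.minimalPeriod α i = 3 then Sum.inr ⟨i, h⟩ else Sum.inl (α.symm i))
    (fun w => Sum.inl w.1)
  left_inv := by
    rintro (i | ⟨i, hi⟩)
    · by_cases h : Function.minimalPeriod α i = 3
      · simp [h]
      · simp [h, minimalPeriod_apply_eq]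
    · simp [hi]
  right_inv := by
    rintro (i | ⟨i, hi⟩)
    · by_cases h : Function.minimalPeriod α i = 3
      · simp [h]
      · simp [h, minimalPeriod_symm_apply_eq]
    · simp [hi]

theorem eq_or_eq_apply_of_sameCycle {Q : Type*} {A : Perm Q} {p q : Q}
    (hp : A (A p) = p) (h : A.SameCycle p q) : q = p ∨ q = A p := by
  obtain ⟨k, rfl⟩ := h
  have h2 : ((A ^ (2 : ℤ)) p) = p := by
    rw [show (2 : ℤ) = 1 + 1 from rfl, zpow_add, zpow_one, Perm.mul_apply, hp]
  rcases Int.even_or_odd' k with ⟨m, rfl | rfl⟩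
  · left
    rw [zpow_mul]
    exact Perm.zpow_apply_eq_self_of_apply_eq_self h2 m
  · right
    rw [add_comm, zpow_add, zpow_one, Perm.mul_apply, zpow_mul,
      Perm.zpow_apply_eq_self_of_apply_eq_self h2 m]

/-- The underlying (multi)graph of a map `(S, A)`: its vertices are the cycles of `S`, its edges
are the `2`-cycles `(p, A p)` of `A`, and such an edge joins the cycle of `S` containing `p` to the
cycle of `S` containing `A p`. Fixed points of `A` (buds) give no edges. -/
def underlyingGraph {Q : Type*} (S A : Perm Q) : Graph (Cycles S) (Cycles A) where
  vertexSet := Set.univ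
  IsLink e x y := ∃ p : Q, A p ≠ p ∧ A (A p) = p ∧
    e = cycleAt A p ∧ x = cycleAt S p ∧ y = cycleAt S (A p)
  isLink_symm := by
    refine fun e he => ⟨fun x y => ?_⟩
    rintro ⟨p, h1, h2, rfl, rfl, rfl⟩
    refine ⟨A p, ?_, by rw [h2], ?_, rfl, by rw [h2]⟩
    · rw [h2]; exact h1.symm
    · exact Quotient.sound (Perm.sameCycle_apply_right.2 (Perm.SameCycle.refl A p))
  eq_or_eq_of_isLink_of_isLink := by
    rintro e x y v w ⟨p, h1, h2, rfl, rfl, rfl⟩ ⟨q, h3, h4, h5, rfl, rfl⟩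
    have h : A.SameCycle p q := Quotient.exact h5
    rcases eq_or_eq_apply_of_sameCycle h2 h with rfl | rfl
    · left; rfl
    · right; rw [h2]
  left_mem_of_isLink := fun _ _ _ _ => Set.mem_univ _

/-- The associated two-colored graph `G(σ, α)`. -/
def assocGraph {P : Type*} [Finite P] (σ α : Perm P) :
    Graph (Cycles (assocVertexPerm σ α)) (Cycles (assocEdgePerm α)) :=
  underlyingGraph (assocVertexPerm σ α) (assocEdgePerm α)

/-- The set `W(σ, α)` of white vertices of `G(σ, α)`: the cycles consisting of white points. -/
def whiteVertices {P : Type*} [Finite P] (σ α : Perm P) :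
    Set (Cycles (assocVertexPerm σ α)) :=
  Set.range fun w : White α => cycleAt (assocVertexPerm σ α) (Sum.inr w)

/-- A multigraph is connected if it has a vertex and any two vertices are joined by a walk. -/
def GraphConnected {V E : Type*} (G : Graph V E) : Prop :=
  G.vertexSet.Nonempty ∧
    ∀ x ∈ G.vertexSet, ∀ y ∈ G.vertexSet, Relation.ReflTransGen G.Adj x y

/-- A multigraph is acyclic if it contains no cycle, that is, no cyclic sequence of `m + 1 ≥ 1`
distinct vertices and `m + 1` distinct edges in which the `i`-th edge joins the `i`-th vertex to
the next one, indices being read modulo `m + 1`. Loops are cycles with `m = 0`, pairs of parallel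
edges are cycles with `m = 1`. -/
def GraphAcyclic {V E : Type*} (G : Graph V E) : Prop :=
  ¬ ∃ (m : ℕ) (v : Fin (m + 1) → V) (e : Fin (m + 1) → E),
    Function.Injective v ∧ Function.Injective e ∧ ∀ i, G.IsLink (e i) (v i) (v (i + 1))

/-- A tree is a connected acyclic multigraph. -/
def IsTree {V E : Type*} (G : Graph V E) : Prop := GraphConnected G ∧ GraphAcyclic G

/-- `s(G)`: the number of spanning trees of `G`, that is, of subgraphs of `G` that contain all
vertices of `G` and are trees. -/
def numSpanningTrees {V E : Type*} (G : Graph V E) : ℕ :=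
  Nat.card {T : Graph V E // T.IsSpanningSubgraph G ∧ IsTree T}

end

end Hypermap

/-!
For a set `B` of points let `θ_B` be the permutation that `α` induces on `B`, extended by the
identity. If `B` contains no fixed point of `α` and contains with each point of a `2`-cycle also the
other one, then the edges of the associated graph through the points of `B` form, together with all
black vertices and the white vertices they meet, a graph that is connected exactly when `(σ, θ_B)`
is transitive, and whose Euler characteristic is `z(σ) + z(θ_B) - |P|`. So this graph is a tree
exactly when `(σ, θ_B)` is a spanning hypertree, and the spanning trees of `G` without the white
vertices in `S` are in bijection with the sets `B` of this kind that skip exactly the white vertices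
in `S`.

Thus the right-hand side is the sum of `(-2)^(number of skipped 3-cycles)` over these sets `B`. The
sets with `θ_B = θ` consist of the points moved by `θ`, together with at most one point of each
`3`-cycle of `α` that `θ` fixes pointwise: for such a `3`-cycle there are three ways to visit it and
one to skip it, of total weight `3 - 2 = 1`. Hence each spanning hypertree `θ` contributes `1`.
-/

namespace Hypermap

open Equiv

section Setoid

variable {X : Type*}

open Classical in
/-- The finest equivalence relation coarser than `r` that relates `x` to `y`: two points are
equivalent when their classes agree after the class of `y` has been identified with that of `x`. -/
noncomputable def mergeClasses (r : Setoid X) (x y : X) : Setoid X :=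
  Setoid.ker (Function.update id (⟦y⟧ : Quotient r) ⟦x⟧ ∘ Quotient.mk r)

theorem mergeClasses_le_iff {r s : Setoid X} {x y : X} :
    mergeClasses r x y ≤ s ↔ r ≤ s ∧ s x y := by
  classical
  constructor
  · refine fun h => ⟨fun a b hab => h ?_, h ?_⟩
    · exact congrArg (Function.update id (⟦y⟧ : Quotient r) ⟦x⟧) (Quotient.sound hab)
    · rw [mergeClasses, Setoid.ker_def]
      simp [Function.update_apply]
  · rintro ⟨hrs, hxy⟩ a b hab
    let f : Quotient r → Quotient s := Setoid.map_of_le hrs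
    have hf (q : Quotient r) : f (Function.update id ⟦y⟧ ⟦x⟧ q) = f q := by
      rcases eq_or_ne q ⟦y⟧ with rfl | hq
      · rw [Function.update_self]
        exact Quotient.sound hxy
      · rw [Function.update_of_ne hq, id]
    refine Quotient.exact (?_ : f ⟦a⟧ = f ⟦b⟧)
    rw [← hf, ← hf ⟦b⟧]
    exact congrArg f hab

theorem le_mergeClasses (r : Setoid X) (x y : X) : r ≤ mergeClasses r x y :=
  (mergeClasses_le_iff.1 le_rfl).1

theorem mergeClasses_rel (r : Setoid X) (x y : X) : mergeClasses r x y x y :=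
  (mergeClasses_le_iff.1 le_rfl).2

theorem mergeClasses_eq_self {r : Setoid X} {x y : X} (h : r x y) : mergeClasses r x y = r :=
  le_antisymm (mergeClasses_le_iff.2 ⟨le_rfl, h⟩) (le_mergeClasses r x y)

theorem sup_mergeClasses (r s : Setoid X) (x y : X) :
    r ⊔ mergeClasses s x y = mergeClasses (r ⊔ s) x y := by
  refine eq_of_forall_ge_iff fun t => ?_
  rw [sup_le_iff, mergeClasses_le_iff, mergeClasses_le_iff, sup_le_iff, and_assoc]

theorem card_quotient_mergeClasses [Finite X] {r : Setoid X} {x y : X} (h : ¬ r x y) :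
    Nat.card (Quotient (mergeClasses r x y)) + 1 = Nat.card (Quotient r) := by
  classical
  have hxy : (⟦x⟧ : Quotient r) ≠ ⟦y⟧ := fun hxy => h (Quotient.exact hxy)
  have hrange : Set.range (Function.update id (⟦y⟧ : Quotient r) ⟦x⟧ ∘ Quotient.mk r) =
      {⟦y⟧}ᶜ := by
    rw [Quotient.mk_surjective.range_comp]
    ext q
    simp only [Set.mem_range, Set.mem_compl_singleton_iff]
    constructor
    · rintro ⟨p, rfl⟩
      rcases eq_or_ne p ⟦y⟧ with rfl | hp
      · rwa [Function.update_self]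
      · rwa [Function.update_of_ne hp]
    · exact fun hq => ⟨q, Function.update_of_ne hq _ _⟩
  rw [mergeClasses, Nat.card_congr (Setoid.quotientKerEquivRange _), hrange, Nat.card_coe_set_eq,
    ← Set.ncard_singleton (⟦y⟧ : Quotient r), add_comm, Set.ncard_add_ncard_compl]

theorem card_quotient_le_mergeClasses [Finite X] (r : Setoid X) (x y : X) :
    Nat.card (Quotient r) ≤ Nat.card (Quotient (mergeClasses r x y)) + 1 := by
  by_cases h : r x y
  · rw [mergeClasses_eq_self h]
    exact Nat.le_succ _
  · exact (card_quotient_mergeClasses h).ge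

theorem card_quotient_bot (X : Type*) : Nat.card (Quotient (⊥ : Setoid X)) = Nat.card X :=
  Nat.card_congr Setoid.quotientBotEquiv

theorem card_quotient_eq_one_iff (r : Setoid X) :
    Nat.card (Quotient r) = 1 ↔ Nonempty X ∧ r = ⊤ := by
  rw [Nat.card_eq_one_iff_unique, Quotient.subsingleton_iff, nonempty_quotient_iff, and_comm]

theorem ncard_image_eq_of_eq_iff {Y Z : Type*} {f : X → Y} {g : X → Z} {A : Set X}
    (h : ∀ a ∈ A, ∀ b ∈ A, f a = f b ↔ g a = g b) : (f '' A).ncard = (g '' A).ncard := by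
  have hker : Setoid.ker (A.domRestrict f) = Setoid.ker (A.domRestrict g) :=
    Setoid.ext fun a b => h a a.2 b b.2
  rw [← Set.range_domRestrict, ← Set.range_domRestrict, ← Nat.card_coe_set_eq,
    ← Nat.card_coe_set_eq, ← Nat.card_congr (Setoid.quotientKerEquivRange _), hker,
    Nat.card_congr (Setoid.quotientKerEquivRange _)]

end Setoid

section Cycles

variable {P : Type*}

theorem cycleAt_eq_iff {π : Perm P} {p q : P} : cycleAt π p = cycleAt π q ↔ π.SameCycle p q :=
  Quotient.eq

theorem cycleSetoid_le_iff {π : Perm P} {s : Setoid P} :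
    Perm.SameCycle.setoid π ≤ s ↔ ∀ p, s p (π p) := by
  refine ⟨fun h p => h (Perm.sameCycle_apply_right.2 (Perm.SameCycle.refl π p)), ?_⟩
  rintro h p q ⟨k, rfl⟩
  induction k using Int.induction_on with
  | zero => exact s.refl' p
  | succ k ih =>
    rw [add_comm, zpow_one_add, Perm.mul_apply]
    exact s.trans' ih (h _)
  | pred k ih =>
    have hstep := h ((π ^ (-(k : ℤ) - 1)) p)
    rw [← Perm.mul_apply, ← zpow_one_add, add_sub_cancel] at hstep
    exact s.trans' ih (s.symm' hstep)

theorem cycleSetoid_one : Perm.SameCycle.setoid (1 : Perm P) = ⊥ := by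
  rw [eq_bot_iff, cycleSetoid_le_iff]
  exact fun _ => rfl

theorem z_one : z (1 : Perm P) = Nat.card P := by
  rw [z, Cycles, cycleSetoid_one, card_quotient_bot]

theorem orbitRel_closure_pair (σ θ : Perm P) :
    MulAction.orbitRel (Subgroup.closure {σ, θ} : Subgroup (Perm P)) P =
      Perm.SameCycle.setoid σ ⊔ Perm.SameCycle.setoid θ := by
  apply le_antisymm
  · rintro a b ⟨⟨g, hg⟩, rfl⟩
    set s := Perm.SameCycle.setoid σ ⊔ Perm.SameCycle.setoid θ
    suffices hs : ∀ p, s p (g p) from s.symm' (hs b)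
    induction hg using Subgroup.closure_induction with
    | mem x hx =>
      rcases hx with rfl | rfl
      · exact cycleSetoid_le_iff.1 le_sup_left
      · exact cycleSetoid_le_iff.1 le_sup_right
    | one => exact s.refl'
    | mul x y _ _ hx hy => exact fun p => s.trans' (hy p) (hx _)
    | inv x _ hx => exact fun p => s.symm' (by simpa using hx (x⁻¹ p))
  · refine sup_le (cycleSetoid_le_iff.2 fun p => Setoid.symm' _ ?_)
      (cycleSetoid_le_iff.2 fun p => Setoid.symm' _ ?_)
    · exact ⟨⟨σ, Subgroup.subset_closure (Set.mem_insert _ _)⟩, rfl⟩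
    · exact ⟨⟨θ, Subgroup.subset_closure (Set.mem_insert_of_mem _ rfl)⟩, rfl⟩

theorem isHypermap_iff (σ θ : Perm P) :
    IsHypermap σ θ ↔
      Nonempty P ∧ Perm.SameCycle.setoid σ ⊔ Perm.SameCycle.setoid θ = ⊤ := by
  rw [IsHypermap, κ, MulAction.orbitRel.Quotient, orbitRel_closure_pair, card_quotient_eq_one_iff]

theorem not_sameCycle_of_apply_eq_self {π : Perm P} {x y : P} (hx : π x = x) (hxy : x ≠ y) :
    ¬ π.SameCycle x y :=
  fun h => hxy (h.eq_of_left hx)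

theorem cycleSetoid_swap_mul_le [DecidableEq P] (π : Perm P) (x y : P) :
    Perm.SameCycle.setoid (swap x y * π) ≤ mergeClasses (Perm.SameCycle.setoid π) x y := by
  set s := mergeClasses (Perm.SameCycle.setoid π) x y
  have hxy : s x y := mergeClasses_rel _ x y
  refine cycleSetoid_le_iff.2 fun p => ?_
  have hp : s p (π p) := cycleSetoid_le_iff.1 (le_mergeClasses _ x y) p
  rw [Perm.mul_apply, swap_apply_def]
  split_ifs with hx hy
  · exact s.trans' (hx ▸ hp) hxy
  · exact s.trans' (hy ▸ hp) (s.symm' hxy)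
  · exact hp

variable [Finite P]

theorem sameCycle_swap_mul [DecidableEq P] {π : Perm P} {x y : P} (h : ¬ π.SameCycle x y) :
    (swap x y * π).SameCycle x y := by
  set ρ := swap x y * π
  have hpow (n : ℕ) : ρ.SameCycle x ((π ^ n) x) := by
    induction n with
    | zero => exact .refl ρ x
    | succ n ih =>
      rw [pow_succ', Perm.mul_apply]
      by_cases hx : π ((π ^ n) x) = x
      · rw [hx]
      · have hy : π ((π ^ n) x) ≠ y := fun hy =>
          h ⟨(n + 1 : ℕ), by rw [zpow_natCast, pow_succ', Perm.mul_apply, hy]⟩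
        rw [← swap_apply_of_ne_of_ne hx hy, ← Perm.mul_apply]
        exact Perm.sameCycle_apply_right.2 ih
  obtain ⟨n, hn⟩ := (Perm.sameCycle_symm_apply_right.2 (.refl π x)).exists_nat_pow_eq
  have hlast : ρ ((π ^ n) x) = y := by
    rw [hn, Perm.mul_apply, apply_symm_apply, swap_apply_left]
  exact hlast ▸ Perm.sameCycle_apply_right.2 (hpow n)

theorem cycleSetoid_swap_mul [DecidableEq P] {π : Perm P} {x y : P} (h : ¬ π.SameCycle x y) :
    Perm.SameCycle.setoid (swap x y * π) = mergeClasses (Perm.SameCycle.setoid π) x y := by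
  have hxy : Perm.SameCycle.setoid (swap x y * π) x y := sameCycle_swap_mul h
  refine le_antisymm (cycleSetoid_swap_mul_le π x y) (mergeClasses_le_iff.2 ⟨?_, hxy⟩)
  simpa only [swap_mul_self_mul, mergeClasses_eq_self hxy] using
    cycleSetoid_swap_mul_le (swap x y * π) x y

theorem z_swap_mul [DecidableEq P] {π : Perm P} {x y : P} (h : ¬ π.SameCycle x y) :
    z (swap x y * π) + 1 = z π := by
  rw [z, Cycles, cycleSetoid_swap_mul h]
  exact card_quotient_mergeClasses h

@[elab_as_elim]
theorem perm_insert_induction [DecidableEq P] {motive : Perm P → Prop} (one : motive 1)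
    (insert : ∀ (π : Perm P) (x y : P), π x = x → x ≠ y → motive π → motive (swap x y * π))
    (π : Perm P) : motive π := by
  have := Fintype.ofFinite P
  induction h : π.support.card using Nat.strong_induction_on generalizing π with | _ n ih
  by_cases hπ : π = 1
  · rwa [hπ]
  · obtain ⟨x, hx⟩ : ∃ x, π x ≠ x := not_forall.1 fun hfix => hπ (Perm.ext hfix)
    have hmotive := ih _ (h ▸ Perm.card_support_swap_mul hx) (swap x (π x) * π) rfl
    simpa only [swap_mul_self_mul] using
      insert _ x (π x) (by rw [Perm.mul_apply, swap_apply_right]) hx.symm hmotive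

theorem z_add_z_le (σ θ : Perm P) :
    z σ + z θ ≤ Nat.card P +
      Nat.card (Quotient (Perm.SameCycle.setoid σ ⊔ Perm.SameCycle.setoid θ)) := by
  classical
  induction θ using perm_insert_induction with
  | one => rw [z_one, cycleSetoid_one, sup_bot_eq, z, add_comm]
  | insert θ x y hx hxy ih =>
    have hn := not_sameCycle_of_apply_eq_self hx hxy
    have hz := z_swap_mul hn
    have hle := card_quotient_le_mergeClasses
      (Perm.SameCycle.setoid σ ⊔ Perm.SameCycle.setoid θ) x y
    rw [cycleSetoid_swap_mul hn, sup_mergeClasses]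
    omega

/- Write `θ` as a transposition `(x y)` times a permutation `θ'` fixing `x`. Were `x` and `y` on
the same cycle of `σ`, the pair `(σ, θ')` would be connected with too many cycles; hence the
transposition can be moved from `θ` to `σ`, which does not change `θ⁻¹ σ`. -/
theorem z_inv_mul_eq_one (σ θ : Perm P)
    (htop : Perm.SameCycle.setoid σ ⊔ Perm.SameCycle.setoid θ = ⊤)
    (hz : z σ + z θ = Nat.card P + 1) : z (θ⁻¹ * σ) = 1 := by
  classical
  induction θ using perm_insert_induction generalizing σ with
  | one =>
    rw [z_one] at hz
    rw [inv_one, one_mul]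
    omega
  | insert θ x y hx hxy ih =>
    have hθ := not_sameCycle_of_apply_eq_self hx hxy
    have hzθ := z_swap_mul hθ
    rw [cycleSetoid_swap_mul hθ, sup_mergeClasses] at htop
    have hσ : ¬ σ.SameCycle x y := by
      intro hσ
      have hle := z_add_z_le σ θ
      rw [mergeClasses_eq_self ((le_sup_left : Perm.SameCycle.setoid σ ≤ _) hσ)] at htop
      rw [(card_quotient_eq_one_iff _).2 ⟨⟨x⟩, htop⟩] at hle
      omega
    have hzσ := z_swap_mul hσ
    rw [mul_inv_rev, swap_inv, mul_assoc]
    refine ih (swap x y * σ) ?_ (by omega)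
    rwa [cycleSetoid_swap_mul hσ, sup_comm, sup_mergeClasses, sup_comm]

end Cycles

section Multigraph

variable {V E : Type*} {G : Graph V E}

/-- The equivalence relation whose classes are the connected components of `G`; elements of the
ambient type that are not vertices of `G` form classes of their own. -/
def componentSetoid (G : Graph V E) : Setoid V := Relation.EqvGen.setoid G.Adj

theorem componentSetoid_le_iff {s : Setoid V} :
    componentSetoid G ≤ s ↔ ∀ e x y, G.IsLink e x y → s x y := by
  refine ⟨fun h e x y hxy => h (.rel _ _ ⟨e, hxy⟩), fun h => Setoid.eqvGen_le ?_⟩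
  rintro x y ⟨e, hxy⟩
  exact h e x y hxy

theorem componentSetoid_iff_reflTransGen {x y : V} :
    componentSetoid G x y ↔ Relation.ReflTransGen G.Adj x y := by
  have : Std.Symm G.Adj := ⟨fun _ _ h => h.symm⟩
  rw [← Relation.EqvGen.eqvGen_eq_reflTransGen]
  rfl

theorem componentSetoid_eq_bot (h : G.edgeSet = ∅) : componentSetoid G = ⊥ := by
  refine eq_bot_iff.2 (componentSetoid_le_iff.2 fun e x y hxy => ?_)
  exact absurd hxy.edge_mem (h ▸ Set.notMem_empty e)

theorem componentSetoid_eq_mergeClasses {e : E} {x y : V} (h : G.IsLink e x y) :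
    componentSetoid G = mergeClasses (componentSetoid (G.deleteEdges {e})) x y := by
  refine eq_of_forall_ge_iff fun s => ?_
  rw [mergeClasses_le_iff, componentSetoid_le_iff, componentSetoid_le_iff]
  refine ⟨fun hs => ⟨fun f a b hab => hs f a b (hab.mono Graph.deleteEdges_le), hs e x y h⟩, ?_⟩
  rintro ⟨hs, hxy⟩ f a b hab
  rcases eq_or_ne f e with rfl | hf
  · obtain ⟨rfl, rfl⟩ | ⟨rfl, rfl⟩ := h.eq_and_eq_or_eq_and_eq hab
    · exact hxy
    · exact s.symm' hxy
  · exact hs f a b (by simpa using ⟨hab, hf⟩)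

theorem exists_path_of_componentSetoid {x y : V} (h : componentSetoid G x y) :
    ∃ (m : ℕ) (c : Fin (m + 1) → V), Function.Injective c ∧ c 0 = x ∧ c (Fin.last m) = y ∧
      ∀ i : Fin m, G.Adj (c i.castSucc) (c i.succ) := by
  let H : SimpleGraph V := SimpleGraph.fromRel G.Adj
  have hH : componentSetoid G ≤ H.reachableSetoid := componentSetoid_le_iff.2 fun e a b hab => by
    by_cases hne : a = b
    · rw [hne]
    · exact SimpleGraph.Adj.reachable ((SimpleGraph.fromRel_adj _ _ _).2 ⟨hne, .inl ⟨e, hab⟩⟩)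
  obtain ⟨p, hp⟩ := SimpleGraph.Reachable.exists_isPath (hH h : H.Reachable x y)
  refine ⟨p.length, fun i => p.getVert i, fun i j hij => ?_, p.getVert_zero, p.getVert_length,
    fun i => ?_⟩
  · exact Fin.ext (hp.getVert_injOn (Nat.lt_succ_iff.1 i.2) (Nat.lt_succ_iff.1 j.2) hij)
  · have hadj := ((SimpleGraph.fromRel_adj _ _ _).1 (p.adj_getVert_succ i.2)).2
    exact hadj.elim id Graph.Adj.symm

theorem not_componentSetoid_deleteEdges (hG : GraphAcyclic G) {e : E} {x y : V}
    (he : G.IsLink e x y) : ¬ componentSetoid (G.deleteEdges {e}) x y := by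
  intro h
  obtain ⟨m, c, hc, rfl, rfl, hadj⟩ := exists_path_of_componentSetoid h
  choose f hf using hadj
  simp only [Graph.deleteEdges_isLink, Set.mem_singleton_iff] at hf
  have hf_inj : Function.Injective f := fun i j hij => by
    have hi := (hf i).1
    rw [hij] at hi
    obtain ⟨h, -⟩ | ⟨h, h'⟩ := hi.eq_and_eq_or_eq_and_eq (hf j).1
    · exact Fin.castSucc_injective m (hc h)
    · have h₁ := Fin.ext_iff.1 (hc h)
      have h₂ := Fin.ext_iff.1 (hc h')
      simp only [Fin.val_castSucc, Fin.val_succ] at h₁ h₂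
      omega
  refine hG ⟨m, c, Fin.snoc f e, hc, ?_, Fin.lastCases ?_ fun i => ?_⟩
  · exact Fin.snoc_injective_iff.2 ⟨hf_inj, fun ⟨i, hi⟩ => (hf i).2 hi⟩
  · rw [Fin.snoc_last, Fin.last_add_one]
    exact he.symm
  · rw [Fin.snoc_castSucc, Fin.coeSucc_eq_succ]
    exact (hf i).1

theorem exists_componentSetoid_deleteEdges (hG : ¬ GraphAcyclic G) :
    ∃ e x y, G.IsLink e x y ∧ componentSetoid (G.deleteEdges {e}) x y := by
  obtain ⟨m, c, e, -, he, hlink⟩ := not_not.1 hG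
  refine ⟨e (Fin.last m), _, _, hlink _, ?_⟩
  set s := componentSetoid (G.deleteEdges {e (Fin.last m)})
  have hstep (i : Fin m) : s (c i.castSucc) (c i.succ) := by
    refine componentSetoid_le_iff.1 le_rfl (e i.castSucc) _ _ ?_
    simpa [he.eq_iff, (Fin.castSucc_lt_last i).ne] using hlink i.castSucc
  have hpath (i : Fin (m + 1)) : s (c 0) (c i) := by
    induction i using Fin.induction with
    | zero => exact s.refl' _
    | succ i ih => exact s.trans' ih (hstep i)
  rw [Fin.last_add_one]
  exact s.symm' (hpath (Fin.last m))

theorem card_quotient_componentSetoid_add_ncard [Finite V] (hG : GraphConnected G) :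
    Nat.card (Quotient (componentSetoid G)) + G.vertexSet.ncard = Nat.card V + 1 := by
  classical
  obtain ⟨⟨x₀, hx₀⟩, hconn⟩ := hG
  let f : V → V := fun x => if x ∈ G.vertexSet then x₀ else x
  have hker : componentSetoid G = Setoid.ker f := by
    refine le_antisymm (componentSetoid_le_iff.2 fun e x y h => ?_) fun x y hxy => ?_
    · simp [f, Setoid.ker_def, h.left_mem, h.right_mem]
    · by_cases hx : x ∈ G.vertexSet <;> by_cases hy : y ∈ G.vertexSet <;>
        simp only [f, Setoid.ker_def, hx, hy, if_true, if_false] at hxy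
      · exact componentSetoid_iff_reflTransGen.2 (hconn x hx y hy)
      · exact absurd (hxy ▸ hx₀) hy
      · exact absurd (hxy ▸ hx₀) hx
      · exact hxy ▸ Setoid.refl' _ x
  have hrange : Set.range f = insert x₀ G.vertexSetᶜ := by
    ext y
    simp only [Set.mem_range, Set.mem_insert_iff, Set.mem_compl_iff]
    constructor
    · rintro ⟨x, rfl⟩
      by_cases hx : x ∈ G.vertexSet <;> simp [f, hx]
    · rintro (rfl | hy)
      · exact ⟨y, if_pos hx₀⟩
      · exact ⟨y, if_neg hy⟩
  rw [hker, Nat.card_congr (Setoid.quotientKerEquivRange f), hrange, Nat.card_coe_set_eq,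
    Set.ncard_insert_of_notMem (Set.notMem_compl_iff.2 hx₀), add_right_comm,
    add_comm _ G.vertexSet.ncard, Set.ncard_add_ncard_compl]

theorem ncard_edgeSet_deleteEdges_add_one [Finite E] {e : E} (he : e ∈ G.edgeSet) :
    (G.deleteEdges {e}).edgeSet.ncard + 1 = G.edgeSet.ncard := by
  rw [Graph.edgeSet_deleteEdges, Set.ncard_sdiff_singleton_add_one he]

theorem deleteEdges_induction [Finite E] {motive : Graph V E → Prop}
    (empty : ∀ G, G.edgeSet = ∅ → motive G)
    (insert : ∀ (G : Graph V E) (e : E) (x y : V), G.IsLink e x y →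
      motive (G.deleteEdges {e}) → motive G) (G : Graph V E) : motive G := by
  induction h : G.edgeSet.ncard generalizing G with
  | zero => exact empty G ((Set.ncard_eq_zero).1 h)
  | succ n ih =>
    obtain ⟨e, he⟩ := Set.nonempty_of_ncard_ne_zero (by omega : G.edgeSet.ncard ≠ 0)
    obtain ⟨x, y, hxy⟩ := G.exists_isLink_of_mem_edgeSet he
    have hn := ncard_edgeSet_deleteEdges_add_one he
    exact insert G e x y hxy (ih _ (by omega))

variable [Finite V] [Finite E]

theorem card_le_card_quotient_componentSetoid_add (G : Graph V E) :
    Nat.card V ≤ Nat.card (Quotient (componentSetoid G)) + G.edgeSet.ncard := by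
  induction G using deleteEdges_induction with
  | empty G h => rw [componentSetoid_eq_bot h, card_quotient_bot]; exact Nat.le_add_right _ _
  | insert G e x y h ih =>
    have hle := card_quotient_le_mergeClasses (componentSetoid (G.deleteEdges {e})) x y
    have hcard := ncard_edgeSet_deleteEdges_add_one h.edge_mem
    rw [componentSetoid_eq_mergeClasses h]
    omega

theorem graphAcyclic_iff_card_eq (G : Graph V E) :
    GraphAcyclic G ↔
      Nat.card V = Nat.card (Quotient (componentSetoid G)) + G.edgeSet.ncard := by
  constructor
  · intro hG
    induction G using deleteEdges_induction with
    | empty G h => rw [componentSetoid_eq_bot h, card_quotient_bot, h, Set.ncard_empty, add_zero]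
    | insert G e x y h ih =>
      have hcard := ncard_edgeSet_deleteEdges_add_one h.edge_mem
      rw [componentSetoid_eq_mergeClasses h, ih ?_,
        ← card_quotient_mergeClasses (not_componentSetoid_deleteEdges hG h)]
      · omega
      · rintro ⟨m, c, f, hc, hf, hlink⟩
        exact hG ⟨m, c, f, hc, hf, fun i => (hlink i).mono Graph.deleteEdges_le⟩
  · intro hcard
    by_contra hG
    obtain ⟨e, x, y, h, hxy⟩ := exists_componentSetoid_deleteEdges hG
    have hle := card_le_card_quotient_componentSetoid_add (G.deleteEdges {e})
    have hdel := ncard_edgeSet_deleteEdges_add_one h.edge_mem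
    rw [componentSetoid_eq_mergeClasses h, mergeClasses_eq_self hxy] at hcard
    omega

theorem isTree_iff (T : Graph V E) :
    IsTree T ↔ GraphConnected T ∧ T.edgeSet.ncard + 1 = T.vertexSet.ncard := by
  refine and_congr_right fun hconn => ?_
  have hcard := card_quotient_componentSetoid_add_ncard hconn
  rw [graphAcyclic_iff_card_eq]
  omega

end Multigraph

section FirstReturn

variable {P : Type*} [Finite P]

theorem exists_pos_pow_apply_mem (α : Perm P) {B : Set P} {p : P} (hp : p ∈ B) :
    ∃ n, 0 < n ∧ (α ^ n) p ∈ B :=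
  ⟨orderOf α, orderOf_pos α, by rwa [pow_orderOf_eq_one]⟩

open Classical in
theorem injective_firstReturn (α : Perm P) (B : Set P) :
    Function.Injective fun p =>
      if hp : p ∈ B then (α ^ Nat.find (exists_pos_pow_apply_mem α hp)) p else p := by
  have eq_of_le {p q : P} (hp : p ∈ B) {m n : ℕ} (hmn : m ≤ n)
      (hmin : ∀ k < n, ¬ (0 < k ∧ (α ^ k) q ∈ B)) (hm : 0 < m)
      (h : (α ^ m) p = (α ^ n) q) : p = q := by
    rw [← Nat.add_sub_of_le hmn, pow_add, Perm.mul_apply, (α ^ m).injective.eq_iff] at h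
    rcases Nat.eq_zero_or_pos (n - m) with h0 | hpos
    · rwa [h0, pow_zero, Perm.one_apply] at h
    · exact absurd ⟨hpos, h ▸ hp⟩ (hmin (n - m) (by omega))
  intro p q h
  by_cases hp : p ∈ B <;> by_cases hq : q ∈ B <;> simp only [hp, hq, dif_pos, dif_neg,
    not_false_eq_true] at h
  · have hfp := Nat.find_spec (exists_pos_pow_apply_mem α hp)
    have hfq := Nat.find_spec (exists_pos_pow_apply_mem α hq)
    rcases le_total (Nat.find (exists_pos_pow_apply_mem α hp))
      (Nat.find (exists_pos_pow_apply_mem α hq)) with hle | hle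
    · exact eq_of_le hp hle (fun _ => Nat.find_min _) hfp.1 h
    · exact (eq_of_le hq hle (fun _ => Nat.find_min _) hfq.1 h.symm).symm
  · exact absurd (h ▸ (Nat.find_spec (exists_pos_pow_apply_mem α hp)).2) hq
  · exact absurd (h ▸ (Nat.find_spec (exists_pos_pow_apply_mem α hq)).2) hp
  · exact h

open Classical in
/-- The permutation induced by `α` on `B`: it maps each point of `B` to the next point of `B` on
its cycle of `α`, and fixes the points outside `B`. -/
noncomputable def firstReturn (α : Perm P) (B : Set P) : Perm P :=
  Equiv.ofBijective _ (Finite.injective_iff_bijective.1 (injective_firstReturn α B))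

variable {α : Perm P} {B : Set P} {p q : P}

theorem firstReturn_apply_of_notMem (hp : p ∉ B) : firstReturn α B p = p :=
  dif_neg hp

theorem exists_firstReturn_apply_eq (hp : p ∈ B) :
    ∃ n, 0 < n ∧ firstReturn α B p = (α ^ n) p ∧ (α ^ n) p ∈ B ∧
      ∀ k, 0 < k → k < n → (α ^ k) p ∉ B := by
  classical
  obtain ⟨hpos, hmem⟩ := Nat.find_spec (exists_pos_pow_apply_mem α hp)
  exact ⟨_, hpos, dif_pos hp, hmem, fun k hk hlt hB => Nat.find_min _ hlt ⟨hk, hB⟩⟩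

theorem firstReturn_apply_eq (hp : p ∈ B) {n : ℕ} (hn : 0 < n) (hmem : (α ^ n) p ∈ B)
    (hmin : ∀ k, 0 < k → k < n → (α ^ k) p ∉ B) : firstReturn α B p = (α ^ n) p := by
  obtain ⟨m, hm, heq, hmem', hmin'⟩ := exists_firstReturn_apply_eq (α := α) hp
  obtain h | rfl | h := lt_trichotomy m n
  · exact absurd hmem' (hmin m hm h)
  · exact heq
  · exact absurd hmem (hmin' n hn h)

theorem firstReturn_apply_of_apply_mem (hp : p ∈ B) (h : α p ∈ B) : firstReturn α B p = α p :=
  firstReturn_apply_eq (n := 1) hp one_pos h fun k h0 h1 => by omega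

theorem firstReturn_apply_of_apply_notMem (hp : p ∈ B) (h : α p ∉ B) (h' : α (α p) ∈ B) :
    firstReturn α B p = α (α p) := by
  refine firstReturn_apply_eq (n := 2) hp two_pos h' fun k h0 h2 => ?_
  obtain rfl : k = 1 := by omega
  exact h

theorem firstReturn_apply_mem (hp : p ∈ B) : firstReturn α B p ∈ B := by
  obtain ⟨n, -, heq, hmem, -⟩ := exists_firstReturn_apply_eq (α := α) hp
  exact heq ▸ hmem

theorem sameCycle_firstReturn_apply (α : Perm P) (B : Set P) (p : P) :
    α.SameCycle p (firstReturn α B p) := by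
  by_cases hp : p ∈ B
  · obtain ⟨n, -, heq, -⟩ := exists_firstReturn_apply_eq (α := α) hp
    exact ⟨n, by rw [heq, zpow_natCast]⟩
  · rw [firstReturn_apply_of_notMem hp]

theorem firstReturn_apply_congr {B' : Set P} (h : ∀ q, α.SameCycle p q → (q ∈ B ↔ q ∈ B')) :
    firstReturn α B p = firstReturn α B' p := by
  have hpow (n : ℕ) : (α ^ n) p ∈ B ↔ (α ^ n) p ∈ B' := h _ ⟨n, by rw [zpow_natCast]⟩
  have hp' : p ∈ B ↔ p ∈ B' := h p (.refl α p)
  by_cases hp : p ∈ B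
  · obtain ⟨n, hn, heq, hmem, hmin⟩ := exists_firstReturn_apply_eq (α := α) hp
    rw [heq, firstReturn_apply_eq (hp'.1 hp) hn ((hpow n).1 hmem)
      fun k h0 hk hB => hmin k h0 hk ((hpow k).2 hB)]
  · rw [firstReturn_apply_of_notMem hp, firstReturn_apply_of_notMem (hp'.not.1 hp)]

theorem sameCycle_firstReturn_of_mem (hp : p ∈ B) (hq : q ∈ B) (h : α.SameCycle p q) :
    (firstReturn α B).SameCycle p q := by
  obtain ⟨n, rfl⟩ := h.exists_nat_pow_eq
  clear h
  induction n using Nat.strong_induction_on generalizing p with | _ n ih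
  obtain ⟨m, hm, heq, hmem, hmin⟩ := exists_firstReturn_apply_eq (α := α) hp
  rcases Nat.eq_zero_or_pos n with rfl | hn
  · exact .refl _ p
  · have hmn : m ≤ n := le_of_not_gt fun hlt => hmin n hn hlt hq
    rw [← Nat.sub_add_cancel hmn, pow_add, Perm.mul_apply] at hq ⊢
    rw [← Perm.sameCycle_apply_left, heq]
    exact ih (n - m) (by omega) hmem hq

theorem sameCycle_firstReturn_iff :
    (firstReturn α B).SameCycle p q ↔ p = q ∨ p ∈ B ∧ q ∈ B ∧ α.SameCycle p q := by
  constructor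
  · intro h
    by_cases hp : p ∈ B
    · obtain ⟨n, rfl⟩ := h.exists_nat_pow_eq
      clear h
      refine Or.inr ⟨hp, ?_⟩
      induction n with
      | zero => exact ⟨hp, .refl α p⟩
      | succ n ih =>
        rw [pow_succ', Perm.mul_apply]
        exact ⟨firstReturn_apply_mem ih.1, ih.2.trans (sameCycle_firstReturn_apply α B _)⟩
    · exact Or.inl (h.eq_of_left (firstReturn_apply_of_notMem hp))
  · rintro (rfl | ⟨hp, hq, h⟩)
    · exact .refl _ p
    · exact sameCycle_firstReturn_of_mem hp hq h

theorem z_firstReturn_add_ncard (α : Perm P) (B : Set P) :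
    z (firstReturn α B) + B.ncard = Nat.card P + (cycleAt α '' B).ncard := by
  set θ := firstReturn α B
  have hθ {p q : P} : cycleAt θ p = cycleAt θ q ↔ p = q ∨ p ∈ B ∧ q ∈ B ∧ α.SameCycle p q :=
    cycleAt_eq_iff.trans sameCycle_firstReturn_iff
  have hB : (cycleAt θ '' B).ncard = (cycleAt α '' B).ncard := by
    refine ncard_image_eq_of_eq_iff fun p hp q hq => ?_
    rw [hθ, cycleAt_eq_iff]
    exact ⟨fun h => h.elim (fun h => h ▸ .refl α p) (·.2.2), fun h => Or.inr ⟨hp, hq, h⟩⟩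
  have hBc : (cycleAt θ '' Bᶜ).ncard = Bᶜ.ncard :=
    Set.InjOn.ncard_image fun p hp q _ h => (hθ.1 h).resolve_right fun h => hp h.1
  have hdisj : Disjoint (cycleAt θ '' B) (cycleAt θ '' Bᶜ) := by
    rw [Set.disjoint_left]
    rintro _ ⟨p, hp, rfl⟩ ⟨q, hq, h⟩
    exact hq ((hθ.1 h).elim (fun h => h ▸ hp) (·.1))
  have hz : z θ = (cycleAt α '' B).ncard + Bᶜ.ncard := by
    rw [z, ← Set.ncard_univ, ← Quotient.mk_surjective.range_eq, ← Set.image_univ,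
      ← Set.union_compl_self B, Set.image_union, Set.ncard_union_eq hdisj, hB, hBc]
  have hcompl := Set.ncard_add_ncard_compl B
  omega

end FirstReturn

section Genus

variable {X Y : Type*}

theorem z_permCongr (e : X ≃ Y) (π : Perm X) : z (e.permCongr π) = z π := by
  refine (Nat.card_congr (Quotient.congr e fun a b => ?_)).symm
  have hpow (k : ℤ) : (e.permCongr π) ^ k = e.permCongr (π ^ k) :=
    (map_zpow e.permCongrHom π k).symm
  change (∃ k : ℤ, (π ^ k) a = b) ↔ ∃ k : ℤ, ((e.permCongr π) ^ k) (e a) = e b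
  simp only [hpow, Equiv.permCongr_apply, Equiv.symm_apply_apply, EmbeddingLike.apply_eq_iff_eq]

theorem genus_permCongr (e : X ≃ Y) (θ γ : Perm X) :
    genus (e.permCongr θ) (e.permCongr γ) = genus θ γ := by
  have h : (e.permCongr γ)⁻¹ * e.permCongr θ = e.permCongr (γ⁻¹ * θ) := by
    have hmul := (map_mul e.permCongrHom γ⁻¹ θ).symm
    rwa [map_inv] at hmul
  rw [genus, genus, h, z_permCongr, z_permCongr, z_permCongr, Nat.card_congr e]

theorem genus_eq_zero_iff (θ γ : Perm X) :
    genus θ γ = 0 ↔ z θ + z γ + z (γ⁻¹ * θ) = Nat.card X + 2 := by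
  rw [genus, div_eq_zero_iff, or_iff_left two_ne_zero, ← Nat.cast_inj (R := ℚ)]
  push_cast
  constructor <;> intro h <;> linarith

instance decidableCycleSetoid [Fintype X] [DecidableEq X] (π : Perm X) :
    DecidableRel (Perm.SameCycle.setoid π) := inferInstanceAs (DecidableRel (Perm.SameCycle π))

set_option maxRecDepth 100000 in
theorem genus_finRotate_eq_zero_iff {k : ℕ} (hk : k ≤ 2) (θ : Perm (Fin (k + 1))) :
    genus θ (finRotate (k + 1)) = 0 ↔ (k = 2 → ∃ i, θ (finRotate (k + 1) i) ≠ i) := by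
  simp only [genus_eq_zero_iff, z, Nat.card_eq_fintype_card]
  revert θ
  interval_cases k <;> decide

end Genus

section ShortHyperedges

variable {P : Type*} [Finite P] {α : Perm P}

theorem exists_iterate_eq_of_sameCycle {x y : P} (h : α.SameCycle x y) :
    ∃ n < Function.minimalPeriod α x, (α^[n]) x = y := by
  obtain ⟨n, rfl⟩ := h.exists_nat_pow_eq
  refine ⟨n % Function.minimalPeriod α x, Nat.mod_lt _ ?_, ?_⟩
  · exact Function.minimalPeriod_pos_of_mem_periodicPts (α.injective.mem_periodicPts x)
  · rw [Function.iterate_mod_minimalPeriod_eq, Perm.iterate_eq_pow]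

theorem exists_permCongr_finRotate (α : Perm P) {x : P} {k : ℕ}
    (hk : Function.minimalPeriod α x = k + 1) :
    ∃ e : Fin (k + 1) ≃ {y // α.SameCycle x y}, e.permCongr (finRotate (k + 1)) =
      α.subtypePerm (p := fun y => α.SameCycle x y) fun _ => Perm.sameCycle_apply_right := by
  let f (i : Fin (k + 1)) : {y // α.SameCycle x y} :=
    ⟨(α^[i]) x, i, by rw [zpow_natCast, Perm.iterate_eq_pow]⟩
  have hf : Function.Bijective f := by
    refine ⟨fun i j hij => Fin.ext ?_, fun ⟨y, hy⟩ => ?_⟩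
    · exact (Function.iterate_eq_iterate_iff_of_lt_minimalPeriod (by omega) (by omega)).1
        (congrArg Subtype.val hij)
    · obtain ⟨n, hn, rfl⟩ := exists_iterate_eq_of_sameCycle hy
      exact ⟨⟨n, hk ▸ hn⟩, rfl⟩
  have hrotate (i : Fin (k + 1)) : (f (finRotate (k + 1) i) : P) = α (f i) := by
    change (α^[finRotate (k + 1) i]) x = α ((α^[i]) x)
    rw [← Function.iterate_succ_apply' α]
    rcases eq_or_ne i (Fin.last k) with rfl | hi
    · rw [finRotate_last, Fin.val_last, Nat.succ_eq_add_one,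
        show (α^[k + 1]) x = x from hk ▸ Function.iterate_minimalPeriod]
      rfl
    · rw [coe_finRotate_of_ne_last hi]
  refine ⟨Equiv.ofBijective f hf, Perm.ext fun y => Subtype.ext ?_⟩
  obtain ⟨i, rfl⟩ := hf.surjective y
  rw [Equiv.permCongr_apply, Equiv.ofBijective_symm_apply_apply]
  exact hrotate i

theorem genus_subtypePerm_eq_zero_iff (hα : HasShortHyperedges α) {θ : Perm P} {x : P}
    (h : ∀ y, α.SameCycle x (θ y) ↔ α.SameCycle x y) :
    genus (θ.subtypePerm (p := fun y => α.SameCycle x y) h)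
      (α.subtypePerm (p := fun y => α.SameCycle x y) fun _ => Perm.sameCycle_apply_right) = 0 ↔
    (Function.minimalPeriod α x = 3 → ∃ y, α.SameCycle x y ∧ θ (α y) ≠ y) := by
  obtain ⟨k, hk⟩ : ∃ k, Function.minimalPeriod α x = k + 1 := Nat.exists_eq_add_one.2
    (Function.minimalPeriod_pos_of_mem_periodicPts (α.injective.mem_periodicPts x))
  have hk2 : k ≤ 2 := by have := hα x; omega
  obtain ⟨e, he⟩ := exists_permCongr_finRotate α hk
  have happly (i : Fin (k + 1)) : (e (finRotate (k + 1) i) : P) = α (e i) := by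
    have := congrArg Subtype.val (Equiv.congr_fun he (e i))
    rwa [Equiv.permCongr_apply, Equiv.symm_apply_apply] at this
  set τ := θ.subtypePerm (p := fun y => α.SameCycle x y) h
  rw [← he, ← e.permCongr.apply_symm_apply τ, genus_permCongr, genus_finRotate_eq_zero_iff hk2,
    hk, Nat.add_left_inj (m := k) (k := 2)]
  have hτ (i : Fin (k + 1)) :
      e.permCongr.symm τ (finRotate (k + 1) i) = i ↔ θ (α (e i)) = e i := by
    rw [← happly]
    exact (Equiv.symm_apply_eq e).trans Subtype.ext_iff
  simp only [Ne, hτ, e.exists_congr_right (q := fun y : {y // α.SameCycle x y} => ¬ θ (α y) = y),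
    Subtype.exists, exists_prop]

theorem isRefinement_iff (hα : HasShortHyperedges α) (θ : Perm P) :
    IsRefinement θ α ↔ (∀ p, α.SameCycle p (θ p)) ∧
      ∀ x, Function.minimalPeriod α x = 3 → ∃ y, α.SameCycle x y ∧ θ (α y) ≠ y := by
  constructor
  · rintro ⟨h, hg⟩
    exact ⟨fun p => (h p p).2 (.refl α p),
      fun x => (genus_subtypePerm_eq_zero_iff hα (h x)).1 (hg x)⟩
  · rintro ⟨h, hg⟩
    have h' (x y : P) : α.SameCycle x (θ y) ↔ α.SameCycle x y :=
      ⟨fun hxy => hxy.trans (h y).symm, fun hxy => hxy.trans (h y)⟩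
    exact ⟨h', fun x => (genus_subtypePerm_eq_zero_iff hα (h' x)).2 (hg x)⟩

theorem minimalPeriod_eq_three_iff (hα : HasShortHyperedges α) {p : P} :
    Function.minimalPeriod α p = 3 ↔ α (α p) ≠ p := by
  have h2 := Function.isPeriodicPt_iff_minimalPeriod_dvd (f := α) (x := p) (n := 2)
  have hpos := Function.minimalPeriod_pos_of_mem_periodicPts (α.injective.mem_periodicPts p)
  have hle := hα p
  change α (α p) = p ↔ _ at h2
  rw [Ne, h2]
  interval_cases Function.minimalPeriod α p <;> decide

theorem apply_apply_apply (hα : HasShortHyperedges α) {p : P} (h : α (α p) ≠ p) :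
    α (α (α p)) = p := by
  have hper := Function.isPeriodicPt_minimalPeriod α p
  rwa [(minimalPeriod_eq_three_iff hα).2 h] at hper

theorem sameCycle_iff (hα : HasShortHyperedges α) {p q : P} :
    α.SameCycle p q ↔ q = p ∨ q = α p ∨ q = α (α p) := by
  constructor
  · intro h
    obtain ⟨n, hn, rfl⟩ := exists_iterate_eq_of_sameCycle h
    have hn3 := hn.trans_le (hα p)
    interval_cases n
    · exact Or.inl rfl
    · exact Or.inr (Or.inl rfl)
    · exact Or.inr (Or.inr rfl)
  · rintro (rfl | rfl | rfl)
    · exact .refl α _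
    · exact Perm.sameCycle_apply_right.2 (.refl α p)
    · exact Perm.sameCycle_apply_right.2 (Perm.sameCycle_apply_right.2 (.refl α p))

theorem forall_sameCycle_iff (hα : HasShortHyperedges α) {p : P} {motive : P → Prop} :
    (∀ q, α.SameCycle p q → motive q) ↔ motive p ∧ motive (α p) ∧ motive (α (α p)) := by
  simp only [sameCycle_iff hα, or_imp, forall_and, forall_eq]

end ShortHyperedges

section Refinement

variable {P : Type*} [Finite P] {α θ : Perm P} {B : Set P}

theorem isRefinement_firstReturn (hα : HasShortHyperedges α) (B : Set P) :
    IsRefinement (firstReturn α B) α := by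
  refine (isRefinement_iff hα _).2 ⟨sameCycle_firstReturn_apply α B, fun x hx => ?_⟩
  by_contra! hinv
  have hx2 : α (α x) ≠ x := (minimalPeriod_eq_three_iff hα).1 hx
  have hmem {y : P} (hy : α.SameCycle x y) : α y ∈ B := by
    by_contra hB
    have hfix : α y = y := by rw [← firstReturn_apply_of_notMem (α := α) hB, hinv y hy]
    obtain rfl : y = x := hy.symm.eq_of_left hfix
    exact hx2 (by rw [hfix, hfix])
  have hαx : α.SameCycle x (α x) := Perm.sameCycle_apply_right.2 (.refl α x)
  exact hx2 ((firstReturn_apply_of_apply_mem (hmem (.refl α x)) (hmem hαx)).symm.trans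
    (hinv x (.refl α x)))

theorem apply_apply_eq_of_isRefinement (hα : HasShortHyperedges α) (hθ : IsRefinement θ α) {p : P}
    (hp : α (α p) ≠ p) (h : θ p = α (α p)) : θ (α p) = α p := by
  obtain ⟨hcyc, hrot⟩ := (isRefinement_iff hα θ).1 hθ
  have hp1 : α p ≠ p := fun h => hp (by rw [h, h])
  have hp3 : α (α (α p)) = p := apply_apply_apply hα hp
  rcases (sameCycle_iff hα).1 (hcyc (α p)) with h1 | h1 | h1
  · exact h1
  · exact absurd (θ.injective (h1.trans h.symm)) hp1
  rw [hp3] at h1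
  have h2 : θ (α (α p)) = α p := by
    rcases (sameCycle_iff hα).1 (hcyc (α (α p))) with h2 | h2 | h2
    · exact absurd (θ.injective (h2.trans h.symm)) hp
    · exact absurd (α.injective (θ.injective ((h2.trans hp3).trans h1.symm))) hp1
    · rwa [hp3] at h2
  obtain ⟨y, hy, hne⟩ := hrot p ((minimalPeriod_eq_three_iff hα).2 hp)
  exact absurd ((forall_sameCycle_iff hα (motive := fun y => θ (α y) = y)).2
    ⟨h1, h2, by rwa [hp3]⟩ y hy) hne

theorem firstReturn_moved (hα : HasShortHyperedges α) (hθ : IsRefinement θ α) :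
    firstReturn α {p | θ p ≠ p} = θ := by
  ext1 p
  by_cases hp : θ p = p
  · rw [firstReturn_apply_of_notMem (not_not.2 hp), hp]
  rcases (sameCycle_iff hα).1 (((isRefinement_iff hα θ).1 hθ).1 p) with h | h | h
  · exact absurd h hp
  · rw [h]
    refine firstReturn_apply_of_apply_mem hp ?_
    rw [← h]
    exact fun hfix => hp (θ.injective hfix)
  · rw [h]
    refine firstReturn_apply_of_apply_notMem hp ?_ ?_
    · exact not_not.2 (apply_apply_eq_of_isRefinement hα hθ (h ▸ hp) h)
    · rw [← h]
      exact fun hfix => hp (θ.injective hfix)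

/-- A set of points without fixed points of `α` that contains no point or both points of each
`2`-cycle of `α`. -/
def IsAdmissible (α : Perm P) (B : Set P) : Prop :=
  ∀ p ∈ B, α p ≠ p ∧ (α (α p) = p → α p ∈ B)

/-- The sets consisting of the points moved by `θ` and of at most one point of each `3`-cycle of
`α` that `θ` fixes pointwise: these are the admissible sets on which `α` induces `θ`. -/
def IsTraceOf (α θ : Perm P) (B : Set P) : Prop :=
  (∀ p, θ p ≠ p → p ∈ B) ∧ ∀ p ∈ B, θ p = p →
    Function.minimalPeriod α p = 3 ∧ ∀ q ∈ B, α.SameCycle p q → q = p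

theorem IsTraceOf.firstReturn_eq (hα : HasShortHyperedges α) (hθ : IsRefinement θ α)
    (hB : IsTraceOf α θ B) : firstReturn α B = θ := by
  ext1 p
  by_cases hfix : θ p = p
  · rw [hfix]
    by_cases hp : p ∈ B
    · exact (hB.2 p hp hfix).2 _ (firstReturn_apply_mem hp) (sameCycle_firstReturn_apply α B p)
    · exact firstReturn_apply_of_notMem hp
  · conv_rhs => rw [← firstReturn_moved hα hθ]
    refine firstReturn_apply_congr fun q hpq => ⟨fun hq hqfix => ?_, hB.1 q⟩
    exact hfix ((hB.2 q hq hqfix).2 p (hB.1 p hfix) hpq.symm ▸ hqfix)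

theorem IsTraceOf.isAdmissible (hα : HasShortHyperedges α) (hθ : IsRefinement θ α)
    (hB : IsTraceOf α θ B) : IsAdmissible α B := by
  intro p hp
  by_cases hfix : θ p = p
  · have h2 : α (α p) ≠ p := (minimalPeriod_eq_three_iff hα).1 (hB.2 p hp hfix).1
    exact ⟨fun h => h2 (by rw [h, h]), fun h => absurd h h2⟩
  · have hcyc : α.SameCycle p (θ p) := ((isRefinement_iff hα θ).1 hθ).1 p
    refine ⟨fun h => hfix (hcyc.eq_of_left h).symm, fun h => ?_⟩
    have hθp : θ p = α p := (eq_or_eq_apply_of_sameCycle h hcyc).resolve_left hfix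
    exact hB.1 _ (hθp ▸ fun h => hfix (θ.injective h))

theorem IsAdmissible.isTraceOf_firstReturn (hα : HasShortHyperedges α) (hB : IsAdmissible α B) :
    IsTraceOf α (firstReturn α B) B := by
  refine ⟨fun p hp => ?_, fun p hp hfix => ?_⟩
  · exact not_imp_comm.1 firstReturn_apply_of_notMem hp
  · have honly (q : P) (hq : q ∈ B) (hpq : α.SameCycle p q) : q = p :=
      ((sameCycle_firstReturn_of_mem hp hq hpq).eq_of_left hfix).symm
    refine ⟨(minimalPeriod_eq_three_iff hα).2 fun h => (hB p hp).1 ?_, honly⟩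
    exact honly _ ((hB p hp).2 h) (Perm.sameCycle_apply_right.2 (.refl α p))

theorem isTraceOf_iff (hα : HasShortHyperedges α) (hθ : IsRefinement θ α) :
    IsTraceOf α θ B ↔ IsAdmissible α B ∧ firstReturn α B = θ := by
  refine ⟨fun hB => ⟨hB.isAdmissible hα hθ, hB.firstReturn_eq hα hθ⟩, ?_⟩
  rintro ⟨hB, rfl⟩
  exact hB.isTraceOf_firstReturn hα

end Refinement

section SignedSum

theorem sum_prod_filter_eq {A ι R : Type*} [Fintype A] [Fintype ι] [DecidableEq ι]
    [CommSemiring R] (f : A → ι) (F : ι → Finset A → R) :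
    ∑ B : Finset A, ∏ i, F i {a ∈ B | f a = i} =
      ∏ i, ∑ U ∈ ({a | f a = i} : Finset A).powerset, F i U := by
  classical
  rw [Finset.prod_univ_sum]
  refine Finset.sum_nbij' (fun B i => {a ∈ B | f a = i}) (fun U => Finset.univ.biUnion U)
    (fun B _ => ?_) (fun _ _ => Finset.mem_univ _) (fun B _ => ?_) (fun U hU => ?_) fun _ _ => rfl
  · exact Fintype.mem_piFinset.2 fun i => Finset.mem_powerset.2 <|
      Finset.filter_subset_filter _ B.subset_univ
  · ext a
    simp
  · simp only [Fintype.mem_piFinset, Finset.mem_powerset] at hU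
    ext i a
    simp only [Finset.mem_filter, Finset.mem_biUnion, Finset.mem_univ, true_and]
    have hf {j : ι} (ha : a ∈ U j) : f a = j := (Finset.mem_filter.1 (hU j ha)).2
    constructor
    · rintro ⟨⟨j, ha⟩, rfl⟩
      rwa [hf ha]
    · exact fun ha => ⟨⟨i, ha⟩, hf ha⟩

variable {P : Type*} {α : Perm P}

theorem minimalPeriod_eq_of_sameCycle [Finite P] {p q : P} (h : α.SameCycle p q) :
    Function.minimalPeriod α q = Function.minimalPeriod α p := by
  obtain ⟨n, rfl⟩ := h.exists_nat_pow_eq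
  clear h
  induction n with
  | zero => rfl
  | succ n ih => rw [pow_succ', Perm.mul_apply, minimalPeriod_apply_eq, ih]

/-- The set of `3`-cycles of `α`. -/
def threeCycles (α : Perm P) : Set (Cycles α) :=
  cycleAt α '' {p | Function.minimalPeriod α p = 3}

/-- The set of `3`-cycles of `α` that contain no point of `B`. -/
def missedThreeCycles (α : Perm P) (B : Set P) : Set (Cycles α) :=
  threeCycles α \ cycleAt α '' B

theorem cycleAt_mem_threeCycles [Finite P] {p : P} :
    cycleAt α p ∈ threeCycles α ↔ Function.minimalPeriod α p = 3 := by
  constructor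
  · rintro ⟨q, hq, h⟩
    exact (minimalPeriod_eq_of_sameCycle (Quotient.exact h)).trans hq
  · exact fun h => ⟨p, h, rfl⟩

open Classical in
theorem card_filter_cycleAt_eq_three [Fintype P] {C : Cycles α} (hC : C ∈ threeCycles α) :
    ({p | cycleAt α p = C} : Finset P).card = 3 := by
  obtain ⟨x, hx, rfl⟩ := hC
  obtain ⟨e, -⟩ := exists_permCongr_finRotate α (k := 2) hx
  rw [← Fintype.card_subtype, ← Fintype.card_fin 3]
  exact Fintype.card_congr ((Equiv.subtypeEquivRight fun y =>
    cycleAt_eq_iff.trans Perm.sameCycle_comm).trans e.symm)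

open Classical in
theorem isTraceOf_iff_forall_cycles [Fintype P] {θ : Perm P} {B : Finset P} :
    IsTraceOf α θ B ↔ ∀ C : Cycles α,
      if C ∈ threeCycles α ∧ ({p | cycleAt α p = C ∧ θ p ≠ p} : Finset P) = ∅ then
        ({p ∈ B | cycleAt α p = C} : Finset P).card ≤ 1
      else ({p ∈ B | cycleAt α p = C} : Finset P) =
        ({p | cycleAt α p = C ∧ θ p ≠ p} : Finset P) := by
  constructor
  · rintro ⟨hmoved, hfixed⟩ C
    split_ifs with hC
    · refine Finset.card_le_one.2 fun p hp q hq => ?_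
      rw [Finset.mem_filter] at hp hq
      have hfix : θ p = p := by
        by_contra h
        exact Finset.eq_empty_iff_forall_notMem.1 hC.2 p (by simp [hp.2, h])
      exact ((hfixed p hp.1 hfix).2 q hq.1 (Quotient.exact (hp.2.trans hq.2.symm))).symm
    · ext p
      simp only [Finset.mem_filter, Finset.mem_univ, true_and]
      refine ⟨fun ⟨hp, hpC⟩ => ⟨hpC, fun hfix => hC ?_⟩, fun ⟨hpC, hp⟩ => ⟨hmoved p hp, hpC⟩⟩
      obtain ⟨hp3, honly⟩ := hfixed p hp hfix
      refine ⟨hpC ▸ cycleAt_mem_threeCycles.2 hp3, Finset.filter_eq_empty_iff.2 ?_⟩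
      rintro q - ⟨hqC, hq⟩
      exact hq (honly q (hmoved q hq) (Quotient.exact (hpC.trans hqC.symm)) ▸ hfix)
  · intro h
    refine ⟨fun p hp => ?_, fun p hpB hp => ?_⟩
    · have hmem : p ∈ ({q | cycleAt α q = cycleAt α p ∧ θ q ≠ q} : Finset P) := by simp [hp]
      have hC := h (cycleAt α p)
      rw [if_neg fun hempty => Finset.ne_empty_of_mem hmem hempty.2] at hC
      exact (Finset.mem_filter.1 (hC ▸ hmem)).1
    · have hC := h (cycleAt α p)
      have hmem : p ∈ ({q ∈ B | cycleAt α q = cycleAt α p} : Finset P) := by simpa using hpB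
      split_ifs at hC with hfixed
      · refine ⟨cycleAt_mem_threeCycles.1 hfixed.1, fun q hq hpq => ?_⟩
        exact Finset.card_le_one.1 hC q (Finset.mem_filter.2 ⟨hq, Quotient.sound hpq.symm⟩) p hmem
      · rw [hC] at hmem
        exact absurd hp (Finset.mem_filter.1 hmem).2.2

theorem sum_powerset_eq_one {A : Type*} {s : Finset A} (hs : s.card = 3) :
    ∑ U ∈ s.powerset, (if U.card ≤ 1 then if U.card = 0 then (-2) else 1 else 0 : ℤ) = 1 := by
  rw [Finset.sum_powerset_apply_card
    fun n => (if n ≤ 1 then if n = 0 then (-2) else 1 else 0 : ℤ), hs]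
  decide

open Classical in
theorem pow_ncard_missedThreeCycles [Fintype P] (x : ℤ) (B : Finset P) :
    x ^ (missedThreeCycles α B).ncard = ∏ C : Cycles α,
      if C ∈ threeCycles α ∧ ({p ∈ B | cycleAt α p = C} : Finset P) = ∅ then x else 1 := by
  rw [Finset.prod_ite, Finset.prod_const, Finset.prod_const_one, mul_one, ← Set.ncard_coe_finset]
  congr 2
  ext C
  simp [missedThreeCycles, Finset.filter_eq_empty_iff]

open Classical in
theorem sum_isTraceOf [Fintype P] (α θ : Perm P) :
    ∑ B ∈ Finset.univ.filter fun B : Finset P => IsTraceOf α θ B,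
      (-2 : ℤ) ^ (missedThreeCycles α B).ncard = 1 := by
  let moved (C : Cycles α) : Finset P := {p | cycleAt α p = C ∧ θ p ≠ p}
  let F (C : Cycles α) (U : Finset P) : ℤ :=
    if if C ∈ threeCycles α ∧ moved C = ∅ then U.card ≤ 1 else U = moved C then
      if C ∈ threeCycles α ∧ U = ∅ then -2 else 1
    else 0
  have hF (C : Cycles α) : ∑ U ∈ ({p | cycleAt α p = C} : Finset P).powerset, F C U = 1 := by
    by_cases hC : C ∈ threeCycles α ∧ moved C = ∅
    · simp only [F, hC.1, hC.2, and_self, if_true, true_and]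
      simp only [← Finset.card_eq_zero]
      exact sum_powerset_eq_one (card_filter_cycleAt_eq_three hC.1)
    · have hsub : moved C ∈ ({p | cycleAt α p = C} : Finset P).powerset :=
        Finset.mem_powerset.2 (Finset.monotone_filter_right _ fun _ _ => And.left)
      simp only [F, if_neg hC, Finset.sum_ite_eq', hsub, if_true]
  rw [Finset.sum_filter, ← Finset.prod_const_one (s := (Finset.univ : Finset (Cycles α))),
    ← Finset.prod_congr rfl fun C _ => hF C, ← sum_prod_filter_eq]
  refine Finset.sum_congr rfl fun B _ => ?_
  simp only [F, Finset.prod_ite_zero, pow_ncard_missedThreeCycles, isTraceOf_iff_forall_cycles,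
    Finset.mem_univ, true_imp_iff]
  rfl

end SignedSum

section AssociatedGraph

variable {P : Type*} [Finite P]

/-- The black vertex of `G(σ, α)` on which the black point `p` lies. -/
noncomputable def blackVertex (σ α : Perm P) (p : P) : Cycles (assocVertexPerm σ α) :=
  cycleAt (assocVertexPerm σ α) (Sum.inl p)

/-- The white vertex of `G(σ, α)` on which the white point `w` lies. -/
noncomputable def whiteVertex (σ α : Perm P) (w : White α) : Cycles (assocVertexPerm σ α) :=
  cycleAt (assocVertexPerm σ α) (Sum.inr w)

/-- The edge of `G(σ, α)` through the black point `p`; it is a genuine edge only if `α p ≠ p`. -/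
noncomputable def edgeAt (α : Perm P) (p : P) : Cycles (assocEdgePerm α) :=
  cycleAt (assocEdgePerm α) (Sum.inl p)

/-- The endpoint of the edge through the black point `p` that is opposite to `p`. -/
noncomputable def farEnd (σ α : Perm P) (p : P) : Cycles (assocVertexPerm σ α) :=
  cycleAt (assocVertexPerm σ α) (assocEdgePerm α (Sum.inl p))

section Vertices

variable (σ α : Perm P)

theorem assocVertexPerm_zpow_inl (k : ℤ) (p : P) :
    (assocVertexPerm σ α ^ k) (Sum.inl p) = Sum.inl ((σ ^ k) p) := by
  have h := map_zpow (Perm.sumCongrHom P (White α)) (σ, (α.subtypePerm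
    (p := fun i => Function.minimalPeriod α i = 3) (fun i => by rw [minimalPeriod_apply_eq]))⁻¹) k
  exact (congrArg (fun π : Perm (P ⊕ White α) => π (Sum.inl p)) h).symm

theorem assocVertexPerm_zpow_inr (k : ℤ) (w : White α) :
    (assocVertexPerm σ α ^ k) (Sum.inr w) = Sum.inr (((α.subtypePerm
      (p := fun i => Function.minimalPeriod α i = 3)
      (fun i => by rw [minimalPeriod_apply_eq]))⁻¹ ^ k) w) := by
  have h := map_zpow (Perm.sumCongrHom P (White α)) (σ, (α.subtypePerm
    (p := fun i => Function.minimalPeriod α i = 3) (fun i => by rw [minimalPeriod_apply_eq]))⁻¹) k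
  exact (congrArg (fun π : Perm (P ⊕ White α) => π (Sum.inr w)) h).symm

variable {σ α}

theorem blackVertex_eq_iff {p q : P} :
    blackVertex σ α p = blackVertex σ α q ↔ σ.SameCycle p q := by
  rw [blackVertex, blackVertex, Quotient.eq]
  change (∃ k : ℤ, _) ↔ ∃ k : ℤ, _
  simp only [assocVertexPerm_zpow_inl, Sum.inl.injEq]

theorem whiteVertex_eq_iff {v w : White α} :
    whiteVertex σ α v = whiteVertex σ α w ↔ α.SameCycle v w := by
  rw [whiteVertex, whiteVertex, Quotient.eq]
  change (∃ k : ℤ, _) ↔ _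
  simp only [assocVertexPerm_zpow_inr, Sum.inr.injEq]
  change Perm.SameCycle _⁻¹ _ _ ↔ _
  rw [Perm.sameCycle_inv, Perm.sameCycle_subtypePerm]

theorem blackVertex_ne_whiteVertex (p : P) (w : White α) :
    blackVertex σ α p ≠ whiteVertex σ α w := by
  intro h
  obtain ⟨k, hk⟩ := Quotient.exact h
  rw [assocVertexPerm_zpow_inl] at hk
  exact Sum.inl_ne_inr hk

theorem blackVertex_notMem_whiteVertices (p : P) : blackVertex σ α p ∉ whiteVertices σ α := by
  rintro ⟨w, hw⟩
  exact blackVertex_ne_whiteVertex p w hw.symm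

theorem exists_blackVertex_or_whiteVertex (v : Cycles (assocVertexPerm σ α)) :
    (∃ p, blackVertex σ α p = v) ∨ ∃ w, whiteVertex σ α w = v := by
  induction v using Quotient.inductionOn with | _ x
  exact x.rec (fun p => .inl ⟨p, rfl⟩) fun w => .inr ⟨w, rfl⟩

theorem ncard_range_blackVertex : (Set.range (blackVertex σ α)).ncard = z σ := by
  rw [z, ← Set.ncard_univ, ← Quotient.mk_surjective.range_eq, ← Set.image_univ, ← Set.image_univ]
  exact ncard_image_eq_of_eq_iff fun p _ q _ => blackVertex_eq_iff.trans cycleAt_eq_iff.symm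

end Vertices

section Edges

variable {σ α : Perm P} {p q : P}

theorem assocEdgePerm_inl_of_eq (h : Function.minimalPeriod α p = 3) :
    assocEdgePerm α (Sum.inl p) = Sum.inr ⟨p, h⟩ := by
  simp [assocEdgePerm, h]

theorem assocEdgePerm_inl_of_ne (h : Function.minimalPeriod α p ≠ 3) :
    assocEdgePerm α (Sum.inl p) = Sum.inl (α p) := by
  simp [assocEdgePerm, h]

theorem farEnd_of_eq (h : Function.minimalPeriod α p = 3) :
    farEnd σ α p = whiteVertex σ α ⟨p, h⟩ := by
  rw [farEnd, assocEdgePerm_inl_of_eq h, whiteVertex]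

theorem farEnd_of_ne (h : Function.minimalPeriod α p ≠ 3) :
    farEnd σ α p = blackVertex σ α (α p) := by
  rw [farEnd, assocEdgePerm_inl_of_ne h, blackVertex]

theorem apply_apply_of_minimalPeriod_ne (hα : HasShortHyperedges α)
    (h : Function.minimalPeriod α p ≠ 3) : α (α p) = p :=
  not_not.1 (mt (minimalPeriod_eq_three_iff hα).2 h)

theorem assocEdgePerm_apply_apply (hα : HasShortHyperedges α) (x : P ⊕ White α) :
    assocEdgePerm α (assocEdgePerm α x) = x := by
  rcases x with p | w
  · by_cases h : Function.minimalPeriod α p = 3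
    · rw [assocEdgePerm_inl_of_eq h]
      rfl
    · rw [assocEdgePerm_inl_of_ne h, assocEdgePerm_inl_of_ne (by rwa [minimalPeriod_apply_eq]),
        apply_apply_of_minimalPeriod_ne hα h]
  · exact assocEdgePerm_inl_of_eq w.2

theorem cycleAt_assocEdgePerm_apply (x : P ⊕ White α) :
    cycleAt (assocEdgePerm α) (assocEdgePerm α x) = cycleAt (assocEdgePerm α) x :=
  Quotient.sound (Perm.sameCycle_apply_left.2 (.refl _ _))

theorem edgeAt_surjective (α : Perm P) : Function.Surjective (edgeAt α) := by
  intro e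
  induction e using Quotient.inductionOn with | _ x
  rcases x with p | w
  · exact ⟨p, rfl⟩
  · exact ⟨w, cycleAt_assocEdgePerm_apply (Sum.inr w)⟩

theorem edgeAt_eq_iff (hα : HasShortHyperedges α) :
    edgeAt α p = edgeAt α q ↔ q = p ∨ Function.minimalPeriod α p ≠ 3 ∧ q = α p := by
  constructor
  · intro h
    have hx := eq_or_eq_apply_of_sameCycle (assocEdgePerm_apply_apply hα _) (Quotient.exact h)
    by_cases h3 : Function.minimalPeriod α p = 3
    · exact .inl (by simpa [assocEdgePerm_inl_of_eq h3] using hx)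
    · simpa [assocEdgePerm_inl_of_ne h3, h3] using hx
  · rintro (rfl | ⟨h3, rfl⟩)
    · rfl
    · rw [edgeAt, edgeAt, ← assocEdgePerm_inl_of_ne h3, cycleAt_assocEdgePerm_apply]

theorem assocGraph_isLink (hα : HasShortHyperedges α) (hp : α p ≠ p) :
    (assocGraph σ α).IsLink (edgeAt α p) (blackVertex σ α p) (farEnd σ α p) := by
  refine ⟨Sum.inl p, ?_, assocEdgePerm_apply_apply hα _, rfl, rfl, rfl⟩
  by_cases h3 : Function.minimalPeriod α p = 3
  · rw [assocEdgePerm_inl_of_eq h3]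
    exact Sum.inr_ne_inl
  · rw [assocEdgePerm_inl_of_ne h3]
    exact Sum.inl_injective.ne hp

theorem apply_ne_of_edgeAt_mem (hα : HasShortHyperedges α)
    (h : edgeAt α p ∈ (assocGraph σ α).edgeSet) : α p ≠ p := by
  intro hp
  obtain ⟨x, y, q, hq, -, h, -, -⟩ := (assocGraph σ α).exists_isLink_of_mem_edgeSet h
  have h3 : Function.minimalPeriod α p ≠ 3 := fun h3 =>
    (minimalPeriod_eq_three_iff hα).1 h3 (by rw [hp, hp])
  have hfix : assocEdgePerm α (Sum.inl p) = Sum.inl p := by rw [assocEdgePerm_inl_of_ne h3, hp]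
  exact hq (((Quotient.exact h : (assocEdgePerm α).SameCycle _ _).eq_of_left hfix) ▸ hfix)

end Edges

/-- The white vertices of `G(σ, α)` that contain the white copy of a point of `B`. -/
def visitedVertices (σ α : Perm P) (B : Set P) : Set (Cycles (assocVertexPerm σ α)) :=
  whiteVertex σ α '' {w | (w : P) ∈ B}

/-- The white vertices of `G(σ, α)` that contain no white copy of a point of `B`. -/
def skippedVertices (σ α : Perm P) (B : Set P) : Set (Cycles (assocVertexPerm σ α)) :=
  whiteVertices σ α \ visitedVertices σ α B

variable {σ α : Perm P} {B : Set P}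

theorem compl_skippedVertices :
    (skippedVertices σ α B)ᶜ = Set.range (blackVertex σ α) ∪ visitedVertices σ α B := by
  ext v
  rw [skippedVertices, Set.mem_compl_iff, Set.mem_sdiff, not_and_or, not_not, Set.mem_union]
  refine or_congr_left ⟨fun hv => ?_, ?_⟩
  · exact (exists_blackVertex_or_whiteVertex v).resolve_right hv
  · rintro ⟨p, rfl⟩
    exact blackVertex_notMem_whiteVertices p

theorem ncard_image_whiteVertex (A : Set (White α)) :
    (whiteVertex σ α '' A).ncard = (cycleAt α '' (Subtype.val '' A)).ncard := by
  rw [Set.image_image]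
  exact ncard_image_eq_of_eq_iff fun v _ w _ => whiteVertex_eq_iff.trans cycleAt_eq_iff.symm

theorem skippedVertices_eq_image :
    skippedVertices σ α B = whiteVertex σ α '' {w | cycleAt α w ∉ cycleAt α '' B} := by
  ext v
  constructor
  · rintro ⟨⟨w, rfl⟩, hw⟩
    refine ⟨w, ?_, rfl⟩
    rintro ⟨p, hp, h⟩
    have hpw : α.SameCycle p w := Quotient.exact h
    exact hw ⟨⟨p, (minimalPeriod_eq_of_sameCycle hpw.symm).trans w.2⟩, hp, whiteVertex_eq_iff.2 hpw⟩
  · rintro ⟨w, hw, rfl⟩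
    refine ⟨⟨w, rfl⟩, ?_⟩
    rintro ⟨v, hv, h⟩
    exact hw ⟨v, hv, Quotient.sound (whiteVertex_eq_iff.1 h)⟩

theorem ncard_skippedVertices :
    (skippedVertices σ α B).ncard = (missedThreeCycles α B).ncard := by
  rw [skippedVertices_eq_image, ncard_image_whiteVertex]
  congr 1
  ext C
  constructor
  · rintro ⟨_, ⟨w, hw, rfl⟩, rfl⟩
    exact ⟨cycleAt_mem_threeCycles.2 w.2, hw⟩
  · rintro ⟨⟨p, hp, rfl⟩, hB⟩
    exact ⟨p, ⟨⟨p, hp⟩, hB, rfl⟩, rfl⟩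

theorem IsAdmissible.edgeAt_mem_image_iff (hα : HasShortHyperedges α) (hB : IsAdmissible α B)
    {p : P} : edgeAt α p ∈ edgeAt α '' B ↔ p ∈ B := by
  refine ⟨?_, fun h => ⟨p, h, rfl⟩⟩
  rintro ⟨q, hq, h⟩
  obtain rfl | ⟨h3, rfl⟩ := (edgeAt_eq_iff hα).1 h
  · exact hq
  · exact (hB q hq).2 (apply_apply_of_minimalPeriod_ne hα h3)

/-- The subgraph of the associated graph formed by the edges through the points of `B`, without
the white vertices that none of these edges meets. -/
noncomputable def traceGraph (σ α : Perm P) (B : Set P) :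
    Graph (Cycles (assocVertexPerm σ α)) (Cycles (assocEdgePerm α)) :=
  ((assocGraph σ α).induce ((assocGraph σ α).vertexSet \ skippedVertices σ α B)).restrict
    (edgeAt α '' B)

theorem vertexSet_traceGraph :
    (traceGraph σ α B).vertexSet = Set.range (blackVertex σ α) ∪ visitedVertices σ α B := by
  rw [← compl_skippedVertices, Set.compl_eq_univ_sdiff]
  rfl

theorem ncard_vertexSet_traceGraph :
    (traceGraph σ α B).vertexSet.ncard = z σ + (visitedVertices σ α B).ncard := by
  rw [vertexSet_traceGraph, Set.ncard_union_eq, ncard_range_blackVertex]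
  rw [Set.disjoint_left]
  rintro _ ⟨p, rfl⟩ ⟨w, -, hw⟩
  exact blackVertex_ne_whiteVertex p w hw.symm

theorem traceGraph_isLink (hα : HasShortHyperedges α) (hB : IsAdmissible α B) {p : P}
    (hp : p ∈ B) :
    (traceGraph σ α B).IsLink (edgeAt α p) (blackVertex σ α p) (farEnd σ α p) := by
  refine ⟨⟨p, hp, rfl⟩, assocGraph_isLink hα (hB p hp).1, ?_, ?_⟩
  · exact vertexSet_traceGraph.ge (.inl ⟨p, rfl⟩)
  refine vertexSet_traceGraph.ge ?_
  by_cases h3 : Function.minimalPeriod α p = 3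
  · exact .inr ⟨⟨p, h3⟩, hp, (farEnd_of_eq h3).symm⟩
  · exact .inl ⟨α p, (farEnd_of_ne h3).symm⟩

theorem exists_of_traceGraph_isLink (hα : HasShortHyperedges α) (hB : IsAdmissible α B)
    {e : Cycles (assocEdgePerm α)} {x y : Cycles (assocVertexPerm σ α)}
    (h : (traceGraph σ α B).IsLink e x y) :
    ∃ p ∈ B, x = blackVertex σ α p ∧ y = farEnd σ α p ∨
      x = farEnd σ α p ∧ y = blackVertex σ α p := by
  obtain ⟨p, hp, rfl⟩ := h.1
  exact ⟨p, hp, h.eq_and_eq_or_eq_and_eq (traceGraph_isLink hα hB hp)⟩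

theorem edgeSet_traceGraph (hα : HasShortHyperedges α) (hB : IsAdmissible α B) :
    (traceGraph σ α B).edgeSet = edgeAt α '' B := by
  refine Set.Subset.antisymm (fun e he => he.2) ?_
  rintro _ ⟨p, hp, rfl⟩
  exact (traceGraph_isLink hα hB hp).edge_mem

end AssociatedGraph

section EdgeCount

theorem ncard_image_inter_add_ncard_image_sdiff {X Y : Type*} [Finite X] {f : X → Y} {T : Set X}
    (hT : ∀ x y, f x = f y → (x ∈ T ↔ y ∈ T)) (B : Set X) :
    (f '' (B ∩ T)).ncard + (f '' (B \ T)).ncard = (f '' B).ncard := by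
  rw [← Set.ncard_union_eq, ← Set.image_union, Set.inter_union_sdiff]
  rw [Set.disjoint_left]
  rintro _ ⟨x, ⟨-, hx⟩, rfl⟩ ⟨y, ⟨-, hy⟩, h⟩
  exact hy ((hT y x h).2 hx)

variable {P : Type*} [Finite P] {σ α : Perm P} {B : Set P}

theorem minimalPeriod_eq_of_edgeAt_eq (hα : HasShortHyperedges α) {p q : P}
    (h : edgeAt α p = edgeAt α q) : Function.minimalPeriod α p = Function.minimalPeriod α q := by
  obtain rfl | ⟨-, rfl⟩ := (edgeAt_eq_iff hα).1 h
  · rfl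
  · exact (minimalPeriod_apply_eq α p).symm

theorem ncard_edgeAt_image_of_eq_three (hα : HasShortHyperedges α)
    (h3 : ∀ p ∈ B, Function.minimalPeriod α p = 3) : (edgeAt α '' B).ncard = B.ncard :=
  Set.InjOn.ncard_image fun p hp _ _ h =>
    (((edgeAt_eq_iff hα).1 h).resolve_right fun h => h.1 (h3 p hp)).symm

theorem ncard_edgeAt_image_of_ne_three (hα : HasShortHyperedges α)
    (h3 : ∀ p ∈ B, Function.minimalPeriod α p ≠ 3) :
    (edgeAt α '' B).ncard = (cycleAt α '' B).ncard := by
  refine ncard_image_eq_of_eq_iff fun p hp q _ => ?_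
  have h2 : α (α p) = p := apply_apply_of_minimalPeriod_ne hα (h3 p hp)
  rw [edgeAt_eq_iff hα, and_iff_right (h3 p hp), cycleAt_eq_iff, sameCycle_iff hα, h2]
  tauto

theorem IsAdmissible.ncard_eq_two_mul (hα : HasShortHyperedges α) (hB : IsAdmissible α B)
    (h3 : ∀ p ∈ B, Function.minimalPeriod α p ≠ 3) : B.ncard = 2 * (edgeAt α '' B).ncard := by
  classical
  have := Fintype.ofFinite P
  rw [Set.ncard_eq_toFinset_card', Set.ncard_eq_toFinset_card', Set.toFinset_image,
    Finset.card_eq_sum_card_image (edgeAt α), Finset.sum_const_nat (m := 2), mul_comm]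
  intro e he
  obtain ⟨p, hp, rfl⟩ := Finset.mem_image.1 he
  rw [Set.mem_toFinset] at hp
  refine Finset.card_eq_two.2 ⟨p, α p, (hB p hp).1.symm, ?_⟩
  ext q
  rw [Finset.mem_filter, Set.mem_toFinset, Finset.mem_insert, Finset.mem_singleton,
    eq_comm (a := edgeAt α q), edgeAt_eq_iff hα, and_iff_right (h3 p hp), and_iff_right_iff_imp]
  rintro (rfl | rfl)
  · exact hp
  · exact (hB p hp).2 (apply_apply_of_minimalPeriod_ne hα (h3 p hp))

theorem ncard_visitedVertices :
    (visitedVertices σ α B).ncard =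
      (cycleAt α '' (B ∩ {p | Function.minimalPeriod α p = 3})).ncard := by
  rw [visitedVertices, ncard_image_whiteVertex]
  congr 2
  ext p
  constructor
  · rintro ⟨w, hw, rfl⟩
    exact ⟨hw, w.2⟩
  · exact fun hp => ⟨⟨p, hp.2⟩, hp.1, rfl⟩

theorem ncard_edgeSet_add_ncard_cycleAt_image (hα : HasShortHyperedges α)
    (hB : IsAdmissible α B) :
    (traceGraph σ α B).edgeSet.ncard + (cycleAt α '' B).ncard =
      B.ncard + (visitedVertices σ α B).ncard := by
  set T : Set P := {p | Function.minimalPeriod α p = 3}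
  have hcycles := ncard_image_inter_add_ncard_image_sdiff (f := cycleAt α) (T := T)
    (fun p q h => by simp only [T, Set.mem_ofPred_eq,
      minimalPeriod_eq_of_sameCycle (cycleAt_eq_iff.1 h)]) B
  have hedges := ncard_image_inter_add_ncard_image_sdiff (f := edgeAt α) (T := T)
    (fun p q h => by simp only [T, Set.mem_ofPred_eq, minimalPeriod_eq_of_edgeAt_eq hα h]) B
  have hedges₃ := ncard_edgeAt_image_of_eq_three (B := B ∩ T) hα fun p hp => hp.2
  have hcycles₂ := ncard_edgeAt_image_of_ne_three (B := B \ T) hα fun p hp => hp.2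
  have hB₂ : IsAdmissible α (B \ T) := fun p hp => ⟨(hB p hp.1).1, fun h =>
    ⟨(hB p hp.1).2 h, by simpa only [T, Set.mem_ofPred_eq, minimalPeriod_apply_eq] using hp.2⟩⟩
  have hpoints₂ := hB₂.ncard_eq_two_mul hα fun p hp => hp.2
  have hpoints := Set.ncard_inter_add_ncard_sdiff_eq_ncard B T
  have hvisited : (visitedVertices σ α B).ncard = (cycleAt α '' (B ∩ T)).ncard :=
    ncard_visitedVertices
  rw [edgeSet_traceGraph hα hB]
  omega

theorem z_firstReturn_add_ncard_edgeSet (hα : HasShortHyperedges α) (hB : IsAdmissible α B) :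
    z (firstReturn α B) + (traceGraph σ α B).edgeSet.ncard =
      Nat.card P + (visitedVertices σ α B).ncard := by
  have hz := z_firstReturn_add_ncard α B
  have hedges := ncard_edgeSet_add_ncard_cycleAt_image (σ := σ) hα hB
  omega

end EdgeCount

section TraceGraphTree

variable {P : Type*} [Finite P] {σ α : Perm P} {B : Set P}

theorem componentSetoid_blackVertex_farEnd (hα : HasShortHyperedges α) (hB : IsAdmissible α B)
    {p : P} (hp : p ∈ B) :
    componentSetoid (traceGraph σ α B) (blackVertex σ α p) (farEnd σ α p) :=
  componentSetoid_le_iff.1 le_rfl _ _ _ (traceGraph_isLink hα hB hp)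

theorem exists_componentSetoid_blackVertex (hα : HasShortHyperedges α) (hB : IsAdmissible α B)
    {v : Cycles (assocVertexPerm σ α)} (hv : v ∈ (traceGraph σ α B).vertexSet) :
    ∃ p, componentSetoid (traceGraph σ α B) v (blackVertex σ α p) := by
  rw [vertexSet_traceGraph] at hv
  obtain ⟨p, rfl⟩ | ⟨w, hw, rfl⟩ := hv
  · exact ⟨p, Setoid.refl' _ _⟩
  · exact ⟨w, Setoid.symm' _ (farEnd_of_eq w.2 ▸ componentSetoid_blackVertex_farEnd hα hB hw)⟩

theorem componentSetoid_blackVertex_firstReturn (hα : HasShortHyperedges α)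
    (hB : IsAdmissible α B) (p : P) :
    componentSetoid (traceGraph σ α B) (blackVertex σ α p)
      (blackVertex σ α (firstReturn α B p)) := by
  set s := componentSetoid (traceGraph σ α B)
  by_cases hp : p ∈ B
  · have hfar := componentSetoid_blackVertex_farEnd (σ := σ) hα hB hp
    by_cases h3 : Function.minimalPeriod α p = 3
    · have hcyc := sameCycle_firstReturn_apply α B p
      have h3' := (minimalPeriod_eq_of_sameCycle hcyc).trans h3
      have hfar' := componentSetoid_blackVertex_farEnd (σ := σ) hα hB
        (firstReturn_apply_mem (α := α) hp)
      have hends : farEnd σ α p = farEnd σ α (firstReturn α B p) := by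
        rw [farEnd_of_eq h3, farEnd_of_eq h3', whiteVertex_eq_iff]
        exact hcyc
      exact s.trans' hfar (hends ▸ s.symm' hfar')
    · have hmem := (hB p hp).2 (apply_apply_of_minimalPeriod_ne hα h3)
      rwa [firstReturn_apply_of_apply_mem hp hmem, ← farEnd_of_ne h3]
  · rw [firstReturn_apply_of_notMem hp]

theorem rel_of_componentSetoid_blackVertex (hα : HasShortHyperedges α) (hB : IsAdmissible α B)
    {s : Setoid P} (hσs : Perm.SameCycle.setoid σ ≤ s)
    (hθs : Perm.SameCycle.setoid (firstReturn α B) ≤ s) {p q : P}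
    (h : componentSetoid (traceGraph σ α B) (blackVertex σ α p) (blackVertex σ α q)) : s p q := by
  have hθ {i j : P} (hi : i ∈ B) (hj : j ∈ B) (h : α.SameCycle i j) : s i j :=
    hθs (sameCycle_firstReturn_of_mem hi hj h)
  let F (v : Cycles (assocVertexPerm σ α)) : Set P := {j | ∃ i, s i j ∧
    (v = blackVertex σ α i ∨ i ∈ B ∧ ∃ h, v = whiteVertex σ α ⟨i, h⟩)}
  have hblack (i : P) : F (blackVertex σ α i) = {j | s i j} := by
    ext j
    refine ⟨?_, fun h => ⟨i, h, .inl rfl⟩⟩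
    rintro ⟨k, hkj, hik | ⟨-, h, hik⟩⟩
    · exact s.trans' (hσs (blackVertex_eq_iff.1 hik)) hkj
    · exact absurd hik (blackVertex_ne_whiteVertex _ _)
  have hfar (i : P) (hi : i ∈ B) : F (farEnd σ α i) = {j | s i j} := by
    by_cases h3 : Function.minimalPeriod α i = 3
    · rw [farEnd_of_eq h3]
      ext j
      refine ⟨?_, fun h => ⟨i, h, .inr ⟨hi, h3, rfl⟩⟩⟩
      rintro ⟨k, hkj, hik | ⟨hk, h, hik⟩⟩
      · exact absurd hik.symm (blackVertex_ne_whiteVertex _ _)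
      · exact s.trans' (hθ hi hk (whiteVertex_eq_iff.1 hik)) hkj
    · have hmem := (hB i hi).2 (apply_apply_of_minimalPeriod_ne hα h3)
      have hstep := hθ hi hmem (Perm.sameCycle_apply_right.2 (.refl α i))
      rw [farEnd_of_ne h3, hblack]
      exact Set.ext fun j => ⟨s.trans' hstep, s.trans' (s.symm' hstep)⟩
  have hker : componentSetoid (traceGraph σ α B) ≤ Setoid.ker F := by
    refine componentSetoid_le_iff.2 fun e x y h => ?_
    obtain ⟨i, hi, ⟨rfl, rfl⟩ | ⟨rfl, rfl⟩⟩ := exists_of_traceGraph_isLink hα hB h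
    · exact (hblack i).trans (hfar i hi).symm
    · exact (hfar i hi).trans (hblack i).symm
  have hclass : {j | s p j} = {j | s q j} := by
    rw [← hblack, ← hblack]
    exact hker h
  exact hclass.ge (s.refl' q)

theorem componentSetoid_traceGraph_blackVertex_iff (hα : HasShortHyperedges α)
    (hB : IsAdmissible α B) {p q : P} :
    componentSetoid (traceGraph σ α B) (blackVertex σ α p) (blackVertex σ α q) ↔
      (Perm.SameCycle.setoid σ ⊔ Perm.SameCycle.setoid (firstReturn α B)) p q := by
  refine ⟨rel_of_componentSetoid_blackVertex hα hB le_sup_left le_sup_right, fun h => ?_⟩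
  have hle : Perm.SameCycle.setoid σ ⊔ Perm.SameCycle.setoid (firstReturn α B) ≤
      (componentSetoid (traceGraph σ α B)).comap (blackVertex σ α) := by
    refine sup_le (cycleSetoid_le_iff.2 fun i => ?_) (cycleSetoid_le_iff.2 fun i => ?_)
    · rw [Setoid.comap_rel, blackVertex_eq_iff.2 (Perm.sameCycle_apply_right.2 (.refl σ i))]
    · exact componentSetoid_blackVertex_firstReturn hα hB i
  exact hle h

theorem graphConnected_traceGraph_iff (hα : HasShortHyperedges α) (hB : IsAdmissible α B) :
    GraphConnected (traceGraph σ α B) ↔ IsHypermap σ (firstReturn α B) := by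
  have hblack (p : P) : blackVertex σ α p ∈ (traceGraph σ α B).vertexSet :=
    vertexSet_traceGraph.ge (.inl ⟨p, rfl⟩)
  simp only [GraphConnected, isHypermap_iff, Setoid.eq_top_iff,
    ← componentSetoid_iff_reflTransGen, ← componentSetoid_traceGraph_blackVertex_iff hα hB]
  constructor
  · rintro ⟨⟨v, hv⟩, hconn⟩
    exact ⟨⟨(exists_componentSetoid_blackVertex hα hB hv).choose⟩,
      fun p q => hconn _ (hblack p) _ (hblack q)⟩
  · rintro ⟨⟨p⟩, hconn⟩
    refine ⟨⟨_, hblack p⟩, fun x hx y hy => ?_⟩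
    obtain ⟨i, hi⟩ := exists_componentSetoid_blackVertex hα hB hx
    obtain ⟨j, hj⟩ := exists_componentSetoid_blackVertex hα hB hy
    exact Setoid.trans' _ hi (Setoid.trans' _ (hconn i j) (Setoid.symm' _ hj))

theorem isTree_traceGraph_iff (hα : HasShortHyperedges α) (hB : IsAdmissible α B) :
    IsTree (traceGraph σ α B) ↔ IsSpanningHypertree σ α (firstReturn α B) := by
  have hvertices := ncard_vertexSet_traceGraph (σ := σ) (α := α) (B := B)
  have hedges := z_firstReturn_add_ncard_edgeSet (σ := σ) hα hB
  rw [isTree_iff, graphConnected_traceGraph_iff hα hB, IsSpanningHypertree, genus_eq_zero_iff]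
  constructor
  · rintro ⟨hconn, hcard⟩
    have hz : z σ + z (firstReturn α B) = Nat.card P + 1 := by omega
    have hface := z_inv_mul_eq_one σ _ ((isHypermap_iff _ _).1 hconn).2 hz
    exact ⟨isRefinement_firstReturn hα B, hconn, hface, by omega⟩
  · rintro ⟨-, hconn, hface, hgenus⟩
    exact ⟨hconn, by omega⟩

end TraceGraphTree

section SpanningTrees

variable {P : Type*} [Finite P] {σ α : Perm P} {B : Set P}

/-- The black points lying on the edges of `T`; this inverts `traceGraph`. -/
def edgePoints {V : Type*} (α : Perm P) (T : Graph V (Cycles (assocEdgePerm α))) : Set P :=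
  {p | edgeAt α p ∈ T.edgeSet}

theorem edgePoints_traceGraph (hα : HasShortHyperedges α) (hB : IsAdmissible α B) :
    edgePoints α (traceGraph σ α B) = B := by
  ext p
  rw [← hB.edgeAt_mem_image_iff hα, ← edgeSet_traceGraph (σ := σ) hα hB]
  rfl

variable {T : Graph (Cycles (assocVertexPerm σ α)) (Cycles (assocEdgePerm α))}

theorem isAdmissible_edgePoints (hα : HasShortHyperedges α) (hT : T ≤ assocGraph σ α) :
    IsAdmissible α (edgePoints α T) := by
  intro p hp
  have hne : α p ≠ p := apply_ne_of_edgeAt_mem hα (hT.edgeSet_mono hp)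
  refine ⟨hne, fun hinv => ?_⟩
  have h3 : Function.minimalPeriod α p ≠ 3 := fun h3 => (minimalPeriod_eq_three_iff hα).1 h3 hinv
  have hedge : edgeAt α p = edgeAt α (α p) := (edgeAt_eq_iff hα).2 (.inr ⟨h3, rfl⟩)
  exact (congrArg (· ∈ T.edgeSet) hedge).mp hp

theorem isLink_of_mem_edgePoints (hα : HasShortHyperedges α) (hT : T ≤ assocGraph σ α) {p : P}
    (hp : p ∈ edgePoints α T) : T.IsLink (edgeAt α p) (blackVertex σ α p) (farEnd σ α p) :=
  (hT.isLink_iff hp).2 (assocGraph_isLink hα (isAdmissible_edgePoints hα hT p hp).1)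

theorem whiteVertex_mem_visitedVertices_of_adj (hα : HasShortHyperedges α)
    (hT : T ≤ assocGraph σ α) {w : White α} {v : Cycles (assocVertexPerm σ α)}
    (h : T.Adj (whiteVertex σ α w) v) :
    whiteVertex σ α w ∈ visitedVertices σ α (edgePoints α T) := by
  obtain ⟨e, he⟩ := h
  obtain ⟨p, rfl⟩ := edgeAt_surjective α e
  have hp : p ∈ edgePoints α T := he.edge_mem
  obtain ⟨hw, -⟩ | ⟨hw, -⟩ := he.eq_and_eq_or_eq_and_eq (isLink_of_mem_edgePoints hα hT hp)
  · exact absurd hw.symm (blackVertex_ne_whiteVertex p w)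
  by_cases h3 : Function.minimalPeriod α p = 3
  · exact ⟨⟨p, h3⟩, hp, ((farEnd_of_eq h3).symm.trans hw.symm)⟩
  · exact absurd (hw.trans (farEnd_of_ne h3)).symm (blackVertex_ne_whiteVertex (α p) w)

theorem visitedVertices_edgePoints (hα : HasShortHyperedges α) (hT : T ≤ assocGraph σ α)
    (hconn : GraphConnected T) (hblack : ∀ p, blackVertex σ α p ∈ T.vertexSet) :
    visitedVertices σ α (edgePoints α T) = whiteVertices σ α ∩ T.vertexSet := by
  ext v
  constructor
  · rintro ⟨w, hw, rfl⟩
    refine ⟨⟨w, rfl⟩, ?_⟩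
    rw [← farEnd_of_eq w.2]
    exact (isLink_of_mem_edgePoints hα hT hw).right_mem
  · rintro ⟨⟨w, rfl⟩, hw⟩
    obtain h | ⟨v, hadj, -⟩ := (hconn.2 _ hw _ (hblack w)).cases_head
    · exact absurd h.symm (blackVertex_ne_whiteVertex _ w)
    · exact whiteVertex_mem_visitedVertices_of_adj hα hT hadj

theorem traceGraph_edgePoints (hα : HasShortHyperedges α) (hT : T ≤ assocGraph σ α)
    (hconn : GraphConnected T) (hblack : ∀ p, blackVertex σ α p ∈ T.vertexSet) :
    traceGraph σ α (edgePoints α T) = T := by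
  have hadm := isAdmissible_edgePoints hα hT
  have hle : traceGraph σ α (edgePoints α T) ≤ assocGraph σ α :=
    Graph.restrict_le.trans (Graph.induce_le Set.sdiff_subset)
  have hvertex : (traceGraph σ α (edgePoints α T)).vertexSet = T.vertexSet := by
    rw [vertexSet_traceGraph, visitedVertices_edgePoints hα hT hconn hblack]
    refine Set.Subset.antisymm
      (Set.union_subset (Set.range_subset_iff.2 hblack) Set.inter_subset_right) fun v hv => ?_
    obtain ⟨p, rfl⟩ | ⟨w, rfl⟩ := exists_blackVertex_or_whiteVertex v
    · exact .inl ⟨p, rfl⟩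
    · exact .inr ⟨⟨w, rfl⟩, hv⟩
  have hedge : (traceGraph σ α (edgePoints α T)).edgeSet = T.edgeSet := by
    rw [edgeSet_traceGraph hα hadm]
    exact Set.image_preimage_eq _ (edgeAt_surjective α)
  exact (Graph.Compatible.of_le_le hle hT).ext hvertex hedge

theorem traceGraph_edgePoints_of_isSpanningSubgraph (hα : HasShortHyperedges α)
    {S : Set (Cycles (assocVertexPerm σ α))} (hS : S ⊆ whiteVertices σ α)
    (hT : T.IsSpanningSubgraph ((assocGraph σ α).induce ((assocGraph σ α).vertexSet \ S)))
    (hconn : GraphConnected T) :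
    traceGraph σ α (edgePoints α T) = T ∧ skippedVertices σ α (edgePoints α T) = S := by
  have hle : T ≤ assocGraph σ α := hT.le.trans (Graph.induce_le Set.sdiff_subset)
  have hvertex : T.vertexSet = Sᶜ := hT.vertexSet_eq.trans (Set.compl_eq_univ_sdiff S).symm
  have hblack (p : P) : blackVertex σ α p ∈ T.vertexSet :=
    hvertex.ge fun hp => blackVertex_notMem_whiteVertices p (hS hp)
  refine ⟨traceGraph_edgePoints hα hle hconn hblack, ?_⟩
  rw [skippedVertices, visitedVertices_edgePoints hα hle hconn hblack, hvertex,
    Set.sdiff_self_inter, Set.sdiff_compl, Set.inter_eq_right.2 hS]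

end SpanningTrees

section Counting

variable {P : Type*} [Fintype P] {σ α : Perm P}

open Classical in
/-- The sets of points whose trace graph is a spanning tree of the associated graph without the
skipped white vertices. Sorting them by the hypertree they induce and by the vertices they skip
computes the two sides of the theorem. -/
noncomputable def treeTraces (σ α : Perm P) : Finset (Finset P) :=
  Finset.univ.filter fun B : Finset P => IsAdmissible α B ∧
    IsSpanningHypertree σ α (firstReturn α B)

theorem mem_treeTraces {B : Finset P} : B ∈ treeTraces σ α ↔
    IsAdmissible α B ∧ IsSpanningHypertree σ α (firstReturn α B) := by
  simp only [treeTraces, Finset.mem_filter_univ]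

open Classical in
theorem numSpanningTrees_induce_sdiff (hα : HasShortHyperedges α)
    {S : Set (Cycles (assocVertexPerm σ α))} (hS : S ⊆ whiteVertices σ α) :
    numSpanningTrees ((assocGraph σ α).induce ((assocGraph σ α).vertexSet \ S)) =
      ((treeTraces σ α).filter fun B : Finset P => skippedVertices σ α B = S).card := by
  rw [← Set.ncard_coe_finset]
  refine (Nat.card_coe_set_eq {T | _}).trans
    (Set.ncard_congr (fun (B : Finset P) _ => traceGraph σ α B) ?_ ?_ ?_).symm
  · intro B hB
    obtain ⟨htrace, rfl⟩ := Finset.mem_filter.1 hB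
    obtain ⟨hadm, htree⟩ := mem_treeTraces.1 htrace
    exact ⟨⟨Graph.restrict_le, rfl⟩, (isTree_traceGraph_iff hα hadm).2 htree⟩
  · intro B B' hB hB' h
    have hadm := (mem_treeTraces.1 (Finset.mem_filter.1 hB).1).1
    have hadm' := (mem_treeTraces.1 (Finset.mem_filter.1 hB').1).1
    rw [← Finset.coe_inj, ← edgePoints_traceGraph (σ := σ) hα hadm, h,
      edgePoints_traceGraph hα hadm']
  · rintro T ⟨hT, htree⟩
    obtain ⟨htrace, hskip⟩ := traceGraph_edgePoints_of_isSpanningSubgraph hα hS hT htree.1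
    have hadm := isAdmissible_edgePoints hα (hT.le.trans (Graph.induce_le Set.sdiff_subset))
    refine ⟨(edgePoints α T).toFinset, Finset.mem_filter.2 ⟨mem_treeTraces.2 ?_, ?_⟩, ?_⟩ <;>
      rw [Set.coe_toFinset]
    · exact ⟨hadm, (isTree_traceGraph_iff hα hadm).1 (htrace.symm ▸ htree)⟩
    · exact hskip
    · exact htrace

open Classical in
theorem sum_filter_firstReturn_eq (hα : HasShortHyperedges α) {θ : Perm P}
    (hθ : IsSpanningHypertree σ α θ) :
    ∑ B ∈ (treeTraces σ α).filter fun B : Finset P => firstReturn α B = θ,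
      (-2 : ℤ) ^ (skippedVertices σ α B).ncard = 1 := by
  rw [← sum_isTraceOf α θ, treeTraces, Finset.filter_filter]
  refine Finset.sum_congr (Finset.filter_congr fun B _ => ?_) fun B _ =>
    congrArg _ ncard_skippedVertices
  rw [isTraceOf_iff hα hθ.1]
  constructor
  · exact fun h => ⟨h.1.1, h.2⟩
  · rintro ⟨hB, rfl⟩
    exact ⟨⟨hB, hθ⟩, rfl⟩

theorem numSpanningHypertrees_eq_sum (hα : HasShortHyperedges α) :
    (numSpanningHypertrees σ α : ℤ) =
      ∑ B ∈ treeTraces σ α, (-2 : ℤ) ^ (skippedVertices σ α B).ncard := by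
  classical
  have hmaps (B) (hB : B ∈ treeTraces σ α) :
      firstReturn α B ∈ Finset.univ.filter (IsSpanningHypertree σ α) :=
    (Finset.mem_filter_univ _).2 (mem_treeTraces.1 hB).2
  rw [← Finset.sum_fiberwise_of_maps_to hmaps, Finset.sum_congr rfl fun θ hθ =>
    sum_filter_firstReturn_eq hα ((Finset.mem_filter_univ θ).1 hθ), Finset.sum_const, nsmul_one,
    numSpanningHypertrees, Nat.card_eq_fintype_card, Fintype.card_subtype]

open Classical in
theorem sum_filter_skippedVertices_eq (hα : HasShortHyperedges α)
    {S : Finset (Cycles (assocVertexPerm σ α))} (hS : (S : Set _) ⊆ whiteVertices σ α) :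
    ∑ B ∈ (treeTraces σ α).filter fun B : Finset P => skippedVertices σ α B = S,
      (-2 : ℤ) ^ (skippedVertices σ α B).ncard =
    (-2 : ℤ) ^ S.card * (numSpanningTrees
      ((assocGraph σ α).induce ((assocGraph σ α).vertexSet \ S)) : ℤ) := by
  have hconst (B : Finset P)
      (hB : B ∈ (treeTraces σ α).filter fun B : Finset P => skippedVertices σ α B = S) :
      (-2 : ℤ) ^ (skippedVertices σ α B).ncard = (-2 : ℤ) ^ S.card := by
    rw [(Finset.mem_filter.1 hB).2, Set.ncard_coe_finset]
  rw [Finset.sum_congr rfl hconst, Finset.sum_const, nsmul_eq_mul, mul_comm,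
    numSpanningTrees_induce_sdiff hα hS]

end Counting

end Hypermap

theorem mainTheorem3_general {P : Type*} [Finite P] (σ α : Equiv.Perm P)
    (hα : Hypermap.HasShortHyperedges α) :
    (Hypermap.numSpanningHypertrees σ α : ℤ) =
      ∑ S ∈ (Set.toFinite (Hypermap.whiteVertices σ α)).toFinset.powerset,
        (-2 : ℤ) ^ S.card *
          (Hypermap.numSpanningTrees
            ((Hypermap.assocGraph σ α).induce ((Hypermap.assocGraph σ α).vertexSet \ ↑S)) : ℤ) := by
  classical
  have := Fintype.ofFinite P
  let skipped (B : Finset P) := (Set.toFinite (Hypermap.skippedVertices σ α B)).toFinset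
  have hmaps (B) (_ : B ∈ Hypermap.treeTraces σ α) :
      skipped B ∈ (Set.toFinite (Hypermap.whiteVertices σ α)).toFinset.powerset :=
    Finset.mem_powerset.2 (Set.Finite.toFinset_subset_toFinset.2 Set.sdiff_subset)
  rw [Hypermap.numSpanningHypertrees_eq_sum hα, ← Finset.sum_fiberwise_of_maps_to hmaps]
  refine Finset.sum_congr rfl fun S hS => ?_
  have hwhite : (S : Set _) ⊆ Hypermap.whiteVertices σ α := fun w hw =>
    (Set.Finite.mem_toFinset _).1 (Finset.mem_powerset.1 hS hw)
  have hskipped (B : Finset P) : skipped B = S ↔ Hypermap.skippedVertices σ α B = S := by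
    rw [← Finset.coe_inj, Set.Finite.coe_toFinset]
  simp only [hskipped]
  exact Hypermap.sum_filter_skippedVertices_eq hα hwhite

theorem mainTheorem3 {P : Type*} [Finite P] (σ α : Equiv.Perm P)
    (hσα : Hypermap.IsHypermap σ α) (hα : Hypermap.HasShortHyperedges α) :
    (Hypermap.numSpanningHypertrees σ α : ℤ) =
      ∑ S ∈ (Set.toFinite (Hypermap.whiteVertices σ α)).toFinset.powerset,
        (-2 : ℤ) ^ S.card *
          (Hypermap.numSpanningTrees
            ((Hypermap.assocGraph σ α).induce ((Hypermap.assocGraph σ α).vertexSet \ ↑S)) : ℤ) :=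
  mainTheorem3_general σ α hα
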